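/- Let $y_0\in H^1(0,1)$ with $y_0(0)=0$, $y_1\in L^2(0,1)$, $\lambda\in[0,1]$ and $T\in[2,+\infty]$, with $\lambda<1$ if $T=+\infty$. For $u\in L^2(0,T)$ let $y$ be the (weak, finite-energy) solution, continuous in time with values in $H^1(0,1)$ and continuously differentiable in time with values in $L^2(0,1)$, of $$\partial_{tt}y=\partial_{xx}y,\quad 0<x<1,\qquad y(t,0)=0,\quad \partial_x y(t,1)=u(t),\qquad y(0,\cdot)=y_0,\quad \partial_t y(0,\cdot)=y_1 .$$ The optimal control problem $(\mathrm{OCP})_\lambda^T$ is to minimize $$J_\lambda^T(u)=\int_0^T\big((1-\lambda)(\partial_x y(t,0))^2+\lambda u(t)^2\big)\,dt\in[0,+\infty]$$ over all $u\in L^2(0,T)$ such that, if $T<+\infty$, $y(T,\cdot)=\partial_t y(T,\cdot)=0$ (there is no final constraint if $T=+\infty$). Put $$z_\lambda=\frac{-\lambda}{2-\lambda+2\sqrt{1-\lambda}},\qquad F(t)=\begin{cases}\tfrac12\big(y_0'(-t)-y_1(-t)\big),& t\in(-1,0),\\ \tfrac12\big(y_0'(t)+y_1(t)\big),& t\in[0,1).\end{cases}$$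 Then $(\mathrm{OCP})_\lambda^T$ has a unique optimal control $u_\lambda^T\in L^2(0,T)$. Moreover (equalities between controls hold for almost every $t$): 1. Let $T=2n$ with an integer $n\ge 1$. (a) If $\lambda=1$, then $u_1^T(t+2k)=(-1)^k u_1^T(t)$ for $t\in(0,2)$ and every integer $k\ge0$ with $t+2k\le T$ (so $u_1^T$ is 2-anti-periodic and 4-periodic), $u_1^T(t)=\frac1{2n}\big(y_0'(1-t)-y_1(1-t)\big)$ for $t\in(0,1)$, and $u_1^T(t)=\frac1{2n}\big(y_0'(t-1)+y_1(t-1)\big)$ for $t\in(1,2)$. (b) If $0<\lambda<1$, then $z_\lambda\in(-1,0)$ and $u_\lambda^T(t+2k)=z_\lambda^k f_+(t)+z_\lambda^{-k}f_-(t)$ for $t\in(0,2)$ and every integer $k\ge0$ with $t+2k\le T$, where $$f_+(t)=\frac{1+z_\lambda}{1-z_\lambda^{2n}}F(t-1),\qquad f_-(t)=\frac{1+z_\lambda^{-1}}{1-z_\lambda^{-2n}}F(t-1).$$ (c) If $\lambda=0$, then $u_0^T(t)=F(t-1)$ for $t\in(0,2)$ and $u_0^T=0$ on $(2,T)$. 2.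 Let $T=+\infty$ and $0\le\lambda<1$. Then $u_\lambda^\infty(t)=\frac{1+z_\lambda}{2}\big(y_0'(1-t)-y_1(1-t)\big)$ for $t\in(0,1)$, $u_\lambda^\infty(t)=\frac{1+z_\lambda}{2}\big(y_0'(t-1)+y_1(t-1)\big)$ for $t\in(1,2)$, and $u_\lambda^\infty(t+2k)=z_\lambda^k u_\lambda^\infty(t)$ for $t\in(0,2)$ and every integer $k\ge1$. If $\lambda=0$, then $u_0^\infty=u_1^2$ on $[0,2]$. Furthermore there is $C_0>0$, not depending on $(y_0,y_1)$, such that the state $y_\lambda^\infty$ generated by $u_\lambda^\infty$ satisfies $$\int_0^1\Big(\big(\partial_x y_\lambda^\infty(t+2k,x)\big)^2+\big(\partial_t y_\lambda^\infty(t+2k,x)\big)^2\Big)dx\le C_0|z_\lambda|^{2k}\int_0^1\big(y_0'(x)^2+y_1(x)^2\big)dx$$ for every $t\in(0,2)$ and every integer $k\ge1$. -/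

import Mathlib

open MeasureTheory Set Filter Topology
open scoped ENNReal

noncomputable section

namespace WaveOCP

/-- Lebesgue measure on the space interval `(0,1)`. -/
def spaceMeasure : Measure ℝ := volume.restrict (Ioo (0 : ℝ) 1)

/-- The time interval: `[0,T]` if `T < ∞`, and `[0,∞)` if `T = ∞`. -/
def timeInterval (T : ℝ≥0∞) : Set ℝ := {t : ℝ | 0 ≤ t ∧ ENNReal.ofReal t ≤ T}

/-- The space `L²(0,T)` of controls (classes of functions up to equality almost everywhere). -/
abbrev Control (T : ℝ≥0∞) : Type := Lp ℝ 2 (volume.restrict (timeInterval T))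

/-- `f ∈ H¹(0,1)`, for the continuous representative `f` on `[0,1]`: `f` is absolutely continuous
on `[0,1]` and its derivative is square-integrable on `(0,1)`. -/
def MemH1 (f : ℝ → ℝ) : Prop :=
  AbsolutelyContinuousOnInterval f 0 1 ∧ MemLp (deriv f) 2 spaceMeasure

/-- The initial data: `y₀ ∈ H¹(0,1)` with `y₀(0) = 0`, and `y₁ ∈ L²(0,1)`. -/
structure IsInitialData (y₀ y₁ : ℝ → ℝ) : Prop where
  pos_memH1 : MemH1 y₀
  pos_zero : y₀ 0 = 0
  vel_memLp : MemLp y₁ 2 spaceMeasure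

/-- `t ↦ w t` is a continuous map from the set `S` of times into `L²(0,1)`. -/
def ContinuousIntoL2 (S : Set ℝ) (w : ℝ → ℝ → ℝ) : Prop :=
  (∀ t ∈ S, MemLp (w t) 2 spaceMeasure) ∧
  ∀ t ∈ S, Tendsto (fun s => eLpNorm (fun x => w s x - w t x) 2 spaceMeasure) (𝓝[S] t) (𝓝 0)

/-- `v t` is the derivative at time `t`, in `L²(0,1)`, of the map `t ↦ w t`, for every `t ∈ S`
(one-sided at an end point of `S`). -/
def HasTimeDerivL2 (S : Set ℝ) (w v : ℝ → ℝ → ℝ) : Prop :=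
  ∀ t ∈ S, Tendsto
    (fun s => eLpNorm (fun x => (s - t)⁻¹ * (w s x - w t x) - v t x) 2 spaceMeasure)
    (𝓝[S \ {t}] t) (𝓝 0)

/-- `y`, with time derivative `v = ∂ₜy`, is the (finite-energy, weak) solution on the time
interval of
`∂ₜₜ y = ∂ₓₓ y` for `0 < x < 1`, `y(t,0) = 0`, `∂ₓ y(t,1) = u(t)`,
`y(0,·) = y₀`, `∂ₜ y(0,·) = y₁`,
in the class `C⁰(H¹(0,1)) ∩ C¹(L²(0,1))`. The equation and the Neumann condition at `x = 1` are
expressed by the usual weak formulation, integrated in time, tested with all `φ ∈ H¹(0,1)` that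
vanish at `0`. -/
structure IsSolution (T : ℝ≥0∞) (y₀ y₁ u : ℝ → ℝ) (y v : ℝ → ℝ → ℝ) : Prop where
  memH1 : ∀ t ∈ timeInterval T, MemH1 (y t)
  continuous_pos : ContinuousIntoL2 (timeInterval T) y
  continuous_space_deriv : ContinuousIntoL2 (timeInterval T) (fun t => deriv (y t))
  hasTimeDeriv : HasTimeDerivL2 (timeInterval T) y v
  continuous_vel : ContinuousIntoL2 (timeInterval T) v
  initial_pos : ∀ x ∈ Icc (0 : ℝ) 1, y 0 x = y₀ x
  initial_vel : ∀ᵐ x ∂spaceMeasure, v 0 x = y₁ x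
  dirichlet : ∀ t ∈ timeInterval T, y t 0 = 0
  weak : ∀ φ : ℝ → ℝ, MemH1 φ → φ 0 = 0 → ∀ t ∈ timeInterval T,
    (∫ x in (0 : ℝ)..1, v t x * φ x) - (∫ x in (0 : ℝ)..1, y₁ x * φ x)
        + (∫ s in (0 : ℝ)..t, ∫ x in (0 : ℝ)..1, deriv (y s) x * deriv φ x)
      = (∫ s in (0 : ℝ)..t, u s) * φ 1

/-- `g` is the Neumann trace `g(t) = ∂ₓ y(t,0)` of the solution `y` at the end `x = 0`:
it is locally square-integrable on the time interval, and Green's formula holds for all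
`φ ∈ H¹(0,1)`, with the boundary contribution of `x = 0`. This determines `g` almost
everywhere (take `φ(0) ≠ 0`). -/
structure IsNeumannTraceAtZero (T : ℝ≥0∞) (y₁ u : ℝ → ℝ) (y v : ℝ → ℝ → ℝ) (g : ℝ → ℝ) :
    Prop where
  memLp : ∀ t ∈ timeInterval T, MemLp g 2 (volume.restrict (Ioc 0 t))
  green : ∀ φ : ℝ → ℝ, MemH1 φ → ∀ t ∈ timeInterval T,
    (∫ x in (0 : ℝ)..1, v t x * φ x) - (∫ x in (0 : ℝ)..1, y₁ x * φ x)
        + (∫ s in (0 : ℝ)..t, ∫ x in (0 : ℝ)..1, deriv (y s) x * deriv φ x)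
      = (∫ s in (0 : ℝ)..t, u s) * φ 1 - (∫ s in (0 : ℝ)..t, g s) * φ 0

/-- The state is at rest at the final time `T` (no condition if `T = ∞`). -/
def IsAtRestAtEnd (T : ℝ≥0∞) (y v : ℝ → ℝ → ℝ) : Prop :=
  T ≠ ∞ → (∀ x ∈ Icc (0 : ℝ) 1, y T.toReal x = 0) ∧ ∀ᵐ x ∂spaceMeasure, v T.toReal x = 0

/-- The control `u ∈ L²(0,T)` generates from `(y₀,y₁)` the state `y`, with `v = ∂ₜy` and
`g = ∂ₓ y(·,0)`, and this state satisfies the final constraint. -/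
structure IsFeasible (T : ℝ≥0∞) (y₀ y₁ : ℝ → ℝ) (u : Control T)
    (y v : ℝ → ℝ → ℝ) (g : ℝ → ℝ) : Prop where
  isSolution : IsSolution T y₀ y₁ u y v
  isTrace : IsNeumannTraceAtZero T y₁ u y v g
  atRest : IsAtRestAtEnd T y v

/-- The objective functional `∫₀ᵀ ((1-λ) (∂ₓ y(t,0))² + λ u(t)²) dt`, as an element of `[0,∞]`. -/
def cost (T : ℝ≥0∞) (lam : ℝ) (u g : ℝ → ℝ) : ℝ≥0∞ :=
  ∫⁻ t in timeInterval T, ENNReal.ofReal ((1 - lam) * g t ^ 2 + lam * u t ^ 2)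

/-- `u` is an optimal control for the problem with horizon `T`, weight `lam` and initial data
`(y₀,y₁)`: it is feasible and its cost is at most the cost of every feasible control. -/
def IsOptimal (T : ℝ≥0∞) (lam : ℝ) (y₀ y₁ : ℝ → ℝ) (u : Control T) : Prop :=
  ∃ (y v : ℝ → ℝ → ℝ) (g : ℝ → ℝ), IsFeasible T y₀ y₁ u y v g ∧
    ∀ (u' : Control T) (y' v' : ℝ → ℝ → ℝ) (g' : ℝ → ℝ), IsFeasible T y₀ y₁ u' y' v' g' →
      cost T lam u g ≤ cost T lam u' g'

/-- The number `z_λ`. -/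
def zRoot (lam : ℝ) : ℝ := -lam / (2 - lam + 2 * √(1 - lam))

/-- The function `F` on `(-1,1)`. -/
def F (y₀ y₁ : ℝ → ℝ) (t : ℝ) : ℝ :=
  if t < 0 then (1 / 2) * (deriv y₀ (-t) - y₁ (-t)) else (1 / 2) * (deriv y₀ t + y₁ t)

/-- The function `f₊` on `(0,2)`, for the horizon `2n`. -/
def fPlus (lam : ℝ) (n : ℕ) (y₀ y₁ : ℝ → ℝ) (t : ℝ) : ℝ :=
  (1 + zRoot lam) / (1 - zRoot lam ^ (2 * n)) * F y₀ y₁ (t - 1)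

/-- The function `f₋` on `(0,2)`, for the horizon `2n`. -/
def fMinus (lam : ℝ) (n : ℕ) (y₀ y₁ : ℝ → ℝ) (t : ℝ) : ℝ :=
  (1 + 1 / zRoot lam) / (1 - 1 / zRoot lam ^ (2 * n)) * F y₀ y₁ (t - 1)

end WaveOCP

end

/-! By d'Alembert's formula and the condition at `x = 0`, a state is governed by one profile `G` of
a single variable: `∂ₓy = G(t + x) + G(t - x)` and `∂ₜy = G(t + x) - G(t - x)`. The control is then
`G(t + 1) + G(t - 1)` and the Neumann trace at `0` is `2 G(t)`. The initial data prescribe `G = F`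
on `(-1, 1)`, rest at a finite time `T` means `G = 0` on `(T - 1, T + 1)`, and between these zones
`G` is free. Energy uniqueness for the weak formulation (`eq_zero_of_weak_energy`,
`IsSolution.l2Path_eq`), together with Green's formula for profiles (`LocL2.green`), makes this
description exhaustive: `IsFeasible.exists_profile` and `IsProfile.isFeasible` translate the control
problem into one about profiles.

The cost is a quadratic form in `G` that couples only points at distance `2`. Its Euler-Lagrange
equation is the three-term recurrence `λ A(x - 2) + (4 - 2λ) A(x) + λ A(x + 2) = 0` on the free
zone. If a square-integrable profile solves it, the cross term with every admissible finite-cost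
variation vanishes, so the cost of a competitor is the cost of `A` plus the cost of the variation
(`lintegral_costDensity_add`). This gives existence and uniqueness of the optimal control at once
(`IsProfile.isOptimal_iff`).

It remains to solve the recurrence on each class `r + 2ℕ`, with value `F r` at the first point. The
characteristic polynomial `λ z² + (4 - 2λ) z + λ` has, for `0 < λ < 1`, the roots `z_λ` and `1 /
z_λ`. The infinite horizon selects `z_λ ^ k`. A finite horizon selects the combination of both
powers that vanishes in the final zone, and for `λ = 1` the double root `-1` gives `(-1) ^ k` times
an affine function. For `λ = 0` the profile is simply zero on the free zone. These scalar sequences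
do not depend on the data, so the optimal profile is a multiplier times the periodic extension of
`F` (`IsMultiplier.optimal_formula`). -/

namespace WaveOCP

/-! ### Uniqueness of weak solutions by an energy argument in `L²(0,1)`. -/

section

/-- Conservation of energy for the time-integrated equation forces the zero solution. -/
theorem eq_zero_of_weak_energy {H : Type*} [NormedAddCommGroup H] [InnerProductSpace ℝ H]
    [CompleteSpace H] {τ : ℝ} (hτ : 0 ≤ τ) {Y V P : ℝ → H}
    (hY : ∀ t ∈ Ico 0 τ, HasDerivWithinAt Y (V t) (Ici t) t)
    (hYc : ContinuousOn Y (Icc 0 τ)) (hPc : ContinuousOn P (Icc 0 τ)) (h0 : Y 0 = 0)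
    (hw : ∀ t ∈ Icc 0 τ, inner ℝ (V t) (Y t) + ∫ s in (0 : ℝ)..t, inner ℝ (P s) (P t) = 0) :
    ∀ t ∈ Icc 0 τ, Y t = 0 := by
  -- Extending `P` by constants beyond `[0, τ]` makes its primitive `W` differentiable everywhere.
  set Q : ℝ → H := IccExtend hτ ((Icc 0 τ).domRestrict P) with hQdef
  have hQc : Continuous Q := (continuousOn_iff_continuous_domRestrict.1 hPc).Icc_extend'
  have hQ : ∀ t ∈ Icc 0 τ, Q t = P t := fun t ht => by
    rw [hQdef, IccExtend_of_mem _ _ ht]; rfl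
  set W : ℝ → H := fun t => ∫ s in (0 : ℝ)..t, Q s with hWdef
  have hW : ∀ t, HasDerivAt W (Q t) t := fun t =>
    (hQc.integral_hasStrictDerivAt 0 t).hasDerivAt
  have hin : ∀ t ∈ Icc 0 τ, inner ℝ (W t) (Q t) = ∫ s in (0 : ℝ)..t, inner ℝ (P s) (P t) := by
    intro t ht
    have h1 := (innerSL ℝ (Q t)).intervalIntegral_comp_comm (μ := volume)
      (hQc.intervalIntegrable 0 t)
    rw [real_inner_comm]
    simp only [innerSL_apply_apply] at h1
    rw [hWdef]
    simp only
    rw [← h1]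
    apply intervalIntegral.integral_congr
    intro s hs
    rw [uIcc_of_le ht.1] at hs
    simp only
    rw [hQ t ht, hQ s ⟨hs.1, hs.2.trans ht.2⟩, real_inner_comm]
  -- Half the right derivative of `‖Y‖² + ‖W‖²` is `⟪Y, V⟫ + ⟪W, P⟫`, which is the left side of
  -- `hw`. The equation is tested with the position, not the velocity, because the velocity is only
  -- in `L²`.
  have hE := constant_of_has_deriv_right_zero (f := fun t => ‖Y t‖ ^ 2 + ‖W t‖ ^ 2) (a := 0)
    (b := τ) ((hYc.norm.pow 2).add
      ((HasDerivAt.continuousOn fun t _ => hW t).norm.pow 2)) (by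
      intro t ht
      have ht' : t ∈ Icc 0 τ := ⟨ht.1, ht.2.le⟩
      have h := (hY t ht).norm_sq.add (hW t).hasDerivWithinAt.norm_sq
      convert! h using 1
      rw [hin t ht', ← mul_add, real_inner_comm, hw t ht', mul_zero])
  intro t ht
  have h := hE t ht
  simp only [h0, hWdef, intervalIntegral.integral_same, norm_zero] at h
  have : ‖Y t‖ ^ 2 = 0 := by
    have := sq_nonneg ‖∫ s in (0 : ℝ)..t, Q s‖
    have := sq_nonneg ‖Y t‖
    nlinarith
  simpa using this

theorem integral_zero_one_eq (f : ℝ → ℝ) :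
    ∫ x in (0 : ℝ)..1, f x = ∫ x, f x ∂spaceMeasure := by
  rw [intervalIntegral.integral_of_le zero_le_one, spaceMeasure, integral_Ioc_eq_integral_Ioo]

instance : IsProbabilityMeasure spaceMeasure := ⟨by simp [spaceMeasure]⟩

theorem ae_spaceMeasure_iff {p : ℝ → Prop} :
    (∀ᵐ x ∂spaceMeasure, p x) ↔ ∀ᵐ x, x ∈ Ioo (0 : ℝ) 1 → p x := by
  rw [spaceMeasure, ae_restrict_iff' measurableSet_Ioo]

theorem MemH1.ae_differentiableAt {f : ℝ → ℝ} (hf : MemH1 f) :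
    ∀ᵐ x ∂spaceMeasure, DifferentiableAt ℝ f x := by
  rw [ae_spaceMeasure_iff]
  filter_upwards [hf.1.ae_differentiableAt] with x hx h
  exact hx (by rw [uIcc_of_le zero_le_one]; exact Ioo_subset_Icc_self h)

theorem MemH1.deriv_sub {f g : ℝ → ℝ} (hf : MemH1 f) (hg : MemH1 g) :
    deriv (f - g) =ᵐ[spaceMeasure] deriv f - deriv g := by
  filter_upwards [hf.ae_differentiableAt, hg.ae_differentiableAt] with x h1 h2
  exact _root_.deriv_sub h1 h2

theorem MemH1.sub {f g : ℝ → ℝ} (hf : MemH1 f) (hg : MemH1 g) : MemH1 (f - g) :=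
  ⟨hf.1.sub hg.1, (memLp_congr_ae (hf.deriv_sub hg)).2 (hf.2.sub hg.2)⟩

theorem MemH1.continuousOn {f : ℝ → ℝ} (hf : MemH1 f) : ContinuousOn f (Icc 0 1) := by
  have := hf.1.continuousOn
  rwa [uIcc_of_le zero_le_one] at this

theorem MemH1.memLp {f : ℝ → ℝ} (hf : MemH1 f) : MemLp f 2 spaceMeasure := by
  obtain ⟨C, hC⟩ := hf.1.exists_bound
  rw [uIcc_of_le zero_le_one] at hC
  refine MemLp.of_bound ?_ C ?_
  · exact ((hf.continuousOn.mono Ioo_subset_Icc_self).aestronglyMeasurable measurableSet_Ioo)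
  · rw [ae_spaceMeasure_iff]
    exact .of_forall fun x hx => hC x (Ioo_subset_Icc_self hx)

theorem Ioo_ae_eq_zero_of_continuousOn {f : ℝ → ℝ} (hf : ContinuousOn f (Icc 0 1))
    (h : ∀ᵐ x ∂spaceMeasure, f x = 0) : ∀ x ∈ Icc (0 : ℝ) 1, f x = 0 := by
  have h1 : EqOn f (fun _ => 0) (Icc 0 1) := by
    refine Measure.eqOn_Icc_of_ae_eq (μ := volume) zero_ne_one ?_ hf continuousOn_const
    rw [← restrict_Ioo_eq_restrict_Icc]
    exact h
  exact h1

theorem timeInterval_zero_mem (T : ℝ≥0∞) : (0 : ℝ) ∈ timeInterval T := by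
  simp [timeInterval]

theorem timeInterval_Icc_subset {T : ℝ≥0∞} {t : ℝ} (ht : t ∈ timeInterval T) :
    Icc 0 t ⊆ timeInterval T :=
  fun _ hs => ⟨hs.1, (ENNReal.ofReal_le_ofReal hs.2).trans ht.2⟩

/-- An `L²(0,1)`-valued map attached to a family of square-integrable functions. -/
noncomputable def l2Path (w : ℝ → ℝ → ℝ) (t : ℝ) : Lp ℝ 2 spaceMeasure := by
  classical exact if h : MemLp (w t) 2 spaceMeasure then h.toLp (w t) else 0

theorem l2Path_eq {w : ℝ → ℝ → ℝ} {t : ℝ} (h : MemLp (w t) 2 spaceMeasure) :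
    l2Path w t = h.toLp (w t) := by
  simp [l2Path, h]

theorem l2Path_coeFn {w : ℝ → ℝ → ℝ} {t : ℝ} (h : MemLp (w t) 2 spaceMeasure) :
    l2Path w t =ᵐ[spaceMeasure] w t := by
  rw [l2Path_eq h]; exact h.coeFn_toLp

theorem ContinuousIntoL2.continuousOn {S : Set ℝ} {w : ℝ → ℝ → ℝ} (h : ContinuousIntoL2 S w) :
    ContinuousOn (l2Path w) S := by
  intro t ht
  rw [ContinuousWithinAt, Lp.tendsto_Lp_iff_tendsto_eLpNorm']
  refine (h.2 t ht).congr' ?_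
  filter_upwards [self_mem_nhdsWithin] with s hs
  apply eLpNorm_congr_ae
  filter_upwards [l2Path_coeFn (h.1 s hs), l2Path_coeFn (h.1 t ht)] with x h1 h2
  simp [h1, h2]

theorem HasTimeDerivL2.hasDerivWithinAt {S : Set ℝ} {w v : ℝ → ℝ → ℝ} (h : HasTimeDerivL2 S w v)
    (hw : ∀ t ∈ S, MemLp (w t) 2 spaceMeasure) (hv : ∀ t ∈ S, MemLp (v t) 2 spaceMeasure)
    {t : ℝ} (ht : t ∈ S) : HasDerivWithinAt (l2Path w) (l2Path v t) S t := by
  rw [hasDerivWithinAt_iff_tendsto_slope, Lp.tendsto_Lp_iff_tendsto_eLpNorm']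
  refine (h t ht).congr' ?_
  filter_upwards [self_mem_nhdsWithin] with s hs
  apply eLpNorm_congr_ae
  rw [slope_def_module]
  filter_upwards [l2Path_coeFn (hw s hs.1), l2Path_coeFn (hw t ht), l2Path_coeFn (hv t ht),
    Lp.coeFn_smul (s - t)⁻¹ (l2Path w s - l2Path w t), Lp.coeFn_sub (l2Path w s) (l2Path w t)]
    with x h1 h2 h3 h4 h5
  simp only [Pi.sub_apply, Pi.smul_apply, smul_eq_mul] at h4 h5 ⊢
  rw [h4, h5, h1, h2, h3]

theorem mem_nhdsGE_of_Icc {S : Set ℝ} {t τ : ℝ} (h : t < τ) (hS : Icc t τ ⊆ S) :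
    S ∈ 𝓝[≥] t := mem_of_superset (Icc_mem_nhdsGE h) hS

section Uniqueness

variable {T : ℝ≥0∞} {y₀ y₁ u u' : ℝ → ℝ} {y v y' v' : ℝ → ℝ → ℝ}

theorem IsSolution.memLp_pos (h : IsSolution T y₀ y₁ u y v) {t : ℝ} (ht : t ∈ timeInterval T) :
    MemLp (y t) 2 spaceMeasure := h.continuous_pos.1 t ht

theorem IsSolution.memLp_vel (h : IsSolution T y₀ y₁ u y v) {t : ℝ} (ht : t ∈ timeInterval T) :
    MemLp (v t) 2 spaceMeasure := h.continuous_vel.1 t ht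

theorem integral_mul_eq_inner {f g : ℝ → ℝ} {f' g' : Lp ℝ 2 spaceMeasure}
    (hf : f' =ᵐ[spaceMeasure] f) (hg : g' =ᵐ[spaceMeasure] g) :
    ∫ x in (0 : ℝ)..1, f x * g x = inner ℝ f' g' := by
  rw [integral_zero_one_eq, L2.inner_def]
  apply integral_congr_ae
  filter_upwards [hf, hg] with x h1 h2
  simp [h1, h2, mul_comm]

/-- Weak solutions with the same data and the same control have the same position in `L²`. -/
theorem IsSolution.l2Path_eq (h : IsSolution T y₀ y₁ u y v) (h' : IsSolution T y₀ y₁ u' y' v')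
    (hu : ∀ t ∈ timeInterval T, ∫ s in (0 : ℝ)..t, u s = ∫ s in (0 : ℝ)..t, u' s)
    {τ : ℝ} (hτ : τ ∈ timeInterval T) : l2Path y τ = l2Path y' τ := by
  have hsub := timeInterval_Icc_subset hτ
  have hcP := (h.continuous_space_deriv.continuousOn.sub
    h'.continuous_space_deriv.continuousOn).mono hsub
  have key := eq_zero_of_weak_energy (τ := τ) hτ.1 (Y := l2Path y - l2Path y')
    (V := l2Path v - l2Path v')
    (P := l2Path (fun t => deriv (y t)) - l2Path (fun t => deriv (y' t))) ?_ ?_ hcP ?_ ?_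
  · exact sub_eq_zero.1 (key τ ⟨hτ.1, le_rfl⟩)
  · intro t ht
    have htS : t ∈ timeInterval T := hsub ⟨ht.1, ht.2.le⟩
    have hd := (h.hasTimeDeriv.hasDerivWithinAt (fun _ => h.memLp_pos) (fun _ => h.memLp_vel)
      htS).sub (h'.hasTimeDeriv.hasDerivWithinAt (fun _ => h'.memLp_pos)
        (fun _ => h'.memLp_vel) htS)
    exact hd.mono_of_mem_nhdsWithin
      (mem_nhdsGE_of_Icc ht.2 ((Icc_subset_Icc_left ht.1).trans hsub))
  · exact (h.continuous_pos.continuousOn.sub h'.continuous_pos.continuousOn).mono hsub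
  · have h0 := timeInterval_zero_mem T
    rw [Pi.sub_apply, sub_eq_zero]
    apply Lp.ext
    refine (l2Path_coeFn (h.memLp_pos h0)).trans (.trans ?_ (l2Path_coeFn (h'.memLp_pos h0)).symm)
    refine ae_spaceMeasure_iff.2 (.of_forall fun x hx => ?_)
    rw [h.initial_pos x (Ioo_subset_Icc_self hx), h'.initial_pos x (Ioo_subset_Icc_self hx)]
  · intro t ht
    have htS : t ∈ timeInterval T := hsub ht
    -- The test function at time `t` is the difference of the two positions at that same time; it is
    -- admissible because both vanish at `0`.
    have hφ := (h.memH1 t htS).sub (h'.memH1 t htS)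
    have hφ0 : (y t - y' t) 0 = 0 := by simp [h.dirichlet t htS, h'.dirichlet t htS]
    have e := h.weak _ hφ hφ0 t htS
    have e' := h'.weak _ hφ hφ0 t htS
    have hΦ : (l2Path y - l2Path y') t =ᵐ[spaceMeasure] y t - y' t := by
      refine (Lp.coeFn_sub _ _).trans ?_
      exact (l2Path_coeFn (h.memLp_pos htS)).sub (l2Path_coeFn (h'.memLp_pos htS))
    have hΦ' : (l2Path (fun t => deriv (y t)) - l2Path (fun t => deriv (y' t))) t
        =ᵐ[spaceMeasure] deriv (y t - y' t) := by
      refine (Lp.coeFn_sub _ _).trans (.trans ?_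
        ((h.memH1 t htS).deriv_sub (h'.memH1 t htS)).symm)
      exact (l2Path_coeFn (h.continuous_space_deriv.1 t htS)).sub
        (l2Path_coeFn (h'.continuous_space_deriv.1 t htS))
    have conv : ∀ {w : ℝ → ℝ → ℝ}, (∀ s ∈ timeInterval T, MemLp (w s) 2 spaceMeasure) →
        ∫ s in (0 : ℝ)..t, ∫ x in (0 : ℝ)..1, w s x * deriv (y t - y' t) x
        = ∫ s in (0 : ℝ)..t, inner ℝ (l2Path w s)
            ((l2Path (fun t => deriv (y t)) - l2Path (fun t => deriv (y' t))) t) := by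
      intro w hw
      apply intervalIntegral.integral_congr
      intro s hs
      rw [uIcc_of_le ht.1] at hs
      exact integral_mul_eq_inner (l2Path_coeFn (hw s (hsub ⟨hs.1, hs.2.trans ht.2⟩))) hΦ'
    rw [conv h.continuous_space_deriv.1, integral_mul_eq_inner (l2Path_coeFn (h.memLp_vel htS)) hΦ]
      at e
    rw [conv h'.continuous_space_deriv.1,
      integral_mul_eq_inner (l2Path_coeFn (h'.memLp_vel htS)) hΦ] at e'
    have hii : ∀ {w : ℝ → ℝ → ℝ}, ContinuousIntoL2 (timeInterval T) w →
        IntervalIntegrable (fun s => inner ℝ (l2Path w s)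
            ((l2Path (fun t => deriv (y t)) - l2Path (fun t => deriv (y' t))) t)) volume 0 t := by
      intro w hw
      apply ContinuousOn.intervalIntegrable
      rw [uIcc_of_le ht.1]
      exact (hw.continuousOn.mono (timeInterval_Icc_subset htS)).inner continuousOn_const
    have hs : ∫ s in (0 : ℝ)..t, inner ℝ
          ((l2Path (fun t => deriv (y t)) - l2Path (fun t => deriv (y' t))) s)
          ((l2Path (fun t => deriv (y t)) - l2Path (fun t => deriv (y' t))) t)
        = (∫ s in (0 : ℝ)..t, inner ℝ (l2Path (fun t => deriv (y t)) s)
          ((l2Path (fun t => deriv (y t)) - l2Path (fun t => deriv (y' t))) t))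
         - ∫ s in (0 : ℝ)..t, inner ℝ (l2Path (fun t => deriv (y' t)) s)
          ((l2Path (fun t => deriv (y t)) - l2Path (fun t => deriv (y' t))) t) := by
      rw [← intervalIntegral.integral_sub (hii h.continuous_space_deriv)
        (hii h'.continuous_space_deriv)]
      simp only [Pi.sub_apply, inner_sub_left]
    rw [hs, Pi.sub_apply (l2Path v), inner_sub_left]
    rw [hu t htS] at e
    linarith

theorem IsSolution.pos_eq (h : IsSolution T y₀ y₁ u y v) (h' : IsSolution T y₀ y₁ u' y' v')
    (hu : ∀ t ∈ timeInterval T, ∫ s in (0 : ℝ)..t, u s = ∫ s in (0 : ℝ)..t, u' s)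
    {t : ℝ} (ht : t ∈ timeInterval T) : ∀ x ∈ Icc (0 : ℝ) 1, y t x = y' t x := by
  have h1 : y t =ᵐ[spaceMeasure] y' t :=
    ((l2Path_coeFn (h.memLp_pos ht)).symm.trans (by rw [h.l2Path_eq h' hu ht])).trans
      (l2Path_coeFn (h'.memLp_pos ht))
  intro x hx
  refine sub_eq_zero.1 (Ioo_ae_eq_zero_of_continuousOn
    ((h.memH1 t ht).continuousOn.sub (h'.memH1 t ht).continuousOn) ?_ x hx)
  filter_upwards [h1] with x hx
  simp [hx]

theorem IsSolution.deriv_eq (h : IsSolution T y₀ y₁ u y v) (h' : IsSolution T y₀ y₁ u' y' v')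
    (hu : ∀ t ∈ timeInterval T, ∫ s in (0 : ℝ)..t, u s = ∫ s in (0 : ℝ)..t, u' s)
    {t : ℝ} (ht : t ∈ timeInterval T) : ∀ x ∈ Ioo (0 : ℝ) 1, deriv (y t) x = deriv (y' t) x := by
  intro x hx
  apply Filter.EventuallyEq.deriv_eq
  filter_upwards [isOpen_Ioo.mem_nhds hx] with z hz
  exact h.pos_eq h' hu ht z (Ioo_subset_Icc_self hz)

/-- Every time lies in a nondegenerate interval of times, so that derivatives in time, even
one-sided ones at the end points, are unique. -/
theorem timeInterval_accPt {T : ℝ≥0∞} (hT : 2 ≤ T) {t : ℝ} (ht : t ∈ timeInterval T) :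
    UniqueDiffWithinAt ℝ (timeInterval T) t := by
  have h2 : (2 : ℝ) ∈ timeInterval T := ⟨by norm_num, by simpa using hT⟩
  by_cases h : t < 2
  · exact (uniqueDiffOn_Icc (by norm_num : (0 : ℝ) < 2) t ⟨ht.1, h.le⟩).mono
      (timeInterval_Icc_subset h2)
  · exact (uniqueDiffOn_Icc (by linarith : (0 : ℝ) < t) t ⟨ht.1, le_rfl⟩).mono
      (timeInterval_Icc_subset ht)

/-- The two positions form the same path in `L²`, and the velocities are its derivative. -/
theorem IsSolution.vel_eq (hT : 2 ≤ T) (h : IsSolution T y₀ y₁ u y v)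
    (h' : IsSolution T y₀ y₁ u' y' v')
    (hu : ∀ t ∈ timeInterval T, ∫ s in (0 : ℝ)..t, u s = ∫ s in (0 : ℝ)..t, u' s)
    {t : ℝ} (ht : t ∈ timeInterval T) : v t =ᵐ[spaceMeasure] v' t := by
  have hd := h.hasTimeDeriv.hasDerivWithinAt (fun _ => h.memLp_pos) (fun _ => h.memLp_vel) ht
  have hd' := h'.hasTimeDeriv.hasDerivWithinAt (fun _ => h'.memLp_pos) (fun _ => h'.memLp_vel) ht
  have hd'' : HasDerivWithinAt (l2Path y) (l2Path v' t) (timeInterval T) t :=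
    hd'.congr (fun s hs => h.l2Path_eq h' hu hs) (h.l2Path_eq h' hu ht)
  have := (timeInterval_accPt hT ht).eq_deriv _ hd hd''
  exact (l2Path_coeFn (h.memLp_vel ht)).symm.trans
    ((by rw [this] : (l2Path v t : ℝ → ℝ) =ᵐ[spaceMeasure] l2Path v' t).trans
      (l2Path_coeFn (h'.memLp_vel ht)))

theorem memH1_const (c : ℝ) : MemH1 (fun _ => c) := by
  refine ⟨?_, by simp⟩
  apply LipschitzOnWith.absolutelyContinuousOnInterval (K := 0)
  exact (LipschitzWith.const c).lipschitzOnWith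

/-- Lebesgue differentiation of the constant primitive settles each `(0, τ)` with `τ ∈ S`. Countably
many such `τ` exhaust `S` up to a null set: a sequence tending to the supremum if `S` is bounded,
the natural numbers otherwise. -/
theorem ae_eq_zero_of_integral_eq_zero {f : ℝ → ℝ} {S : Set ℝ} (hS : S ⊆ Ici 0)
    (hIcc : ∀ t ∈ S, Icc 0 t ⊆ S)
    (hf : ∀ t ∈ S, IntegrableOn f (Ioc 0 t))
    (h : ∀ t ∈ S, ∫ s in (0 : ℝ)..t, f s = 0) : ∀ᵐ t, t ∈ S → f t = 0 := by
  have step : ∀ τ ∈ S, ∀ᵐ t, t ∈ Ioo 0 τ → f t = 0 := by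
    intro τ hτ
    have hτ0 : 0 ≤ τ := hS hτ
    have hi : IntervalIntegrable f volume 0 τ :=
      (intervalIntegrable_iff_integrableOn_Ioc_of_le hτ0).2 (hf τ hτ)
    filter_upwards [hi.ae_hasDerivAt_integral] with t ht htm
    rw [uIcc_of_le hτ0] at ht
    have h1 := ht (Ioo_subset_Icc_self htm) 0 ⟨le_rfl, hτ0⟩
    have h2 : HasDerivAt (fun x => ∫ s in (0 : ℝ)..x, f s) 0 t := by
      refine (hasDerivAt_const t (0 : ℝ)).congr_of_eventuallyEq ?_
      filter_upwards [isOpen_Ioo.mem_nhds htm] with x hx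
      exact h x (hIcc τ hτ (Ioo_subset_Icc_self hx))
    exact h1.unique h2
  by_cases hb : BddAbove S
  · by_cases hne : S.Nonempty
    swap
    · rw [not_nonempty_iff_eq_empty] at hne
      simp [hne]
    obtain ⟨w, -, hw, hwS⟩ := exists_seq_tendsto_sSup hne hb
    have h1 : ∀ᵐ t, ∀ n, t ∈ Ioo 0 (w n) → f t = 0 := ae_all_iff.2 fun n => step _ (hwS n)
    filter_upwards [h1, Measure.ae_ne volume (0 : ℝ), Measure.ae_ne volume (sSup S)]
      with t ht h0 hs htS
    have hlt : t < sSup S := lt_of_le_of_ne (le_csSup hb htS) hs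
    obtain ⟨n, hn⟩ := (hw.eventually (lt_mem_nhds hlt)).exists
    exact ht n ⟨lt_of_le_of_ne (hS htS) (Ne.symm h0), hn⟩
  · have hS' : ∀ n : ℕ, (n : ℝ) ∈ S := by
      intro n
      rw [not_bddAbove_iff] at hb
      obtain ⟨y, hy, hny⟩ := hb n
      exact hIcc y hy ⟨Nat.cast_nonneg n, hny.le⟩
    have h1 : ∀ᵐ t, ∀ n : ℕ, t ∈ Ioo 0 (n : ℝ) → f t = 0 := ae_all_iff.2 fun n => step _ (hS' n)
    filter_upwards [h1, Measure.ae_ne volume (0 : ℝ)] with t ht h0 htS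
    obtain ⟨n, hn⟩ := exists_nat_gt t
    exact ht n ⟨lt_of_le_of_ne (hS htS) (Ne.symm h0), hn⟩

end Uniqueness

end

/-! ### Translations and averages in `L²`. -/

/-- Composition with measure-preserving maps is continuous in the map, for the compact-open
topology; translations depend continuously on the shift. -/
theorem tendsto_eLpNorm_translate {G : ℝ → ℝ} (hG : MemLp G 2 volume) :
    Tendsto (fun s => eLpNorm (fun x => G (s + x) - G x) 2 volume) (𝓝 0) (𝓝 0) := by
  have hmp : ∀ s : ℝ, MeasurePreserving (fun x : ℝ => s + x) volume volume :=
    fun s => measurePreserving_add_left volume s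
  let c : C(ℝ, C(ℝ, ℝ)) := (ContinuousMap.mk (fun p : ℝ × ℝ => p.1 + p.2)
    (by fun_prop)).curry
  have h := Filter.Tendsto.compMeasurePreservingLp (μ := volume) (ν := volume) (p := 2)
    (l := 𝓝 (0 : ℝ)) (f := fun _ => hG.toLp G) (f₀ := hG.toLp G) (g := c) (g₀ := c 0)
    tendsto_const_nhds (c.continuous.tendsto 0) hmp (hmp 0) (by simp)
  rw [Lp.tendsto_Lp_iff_tendsto_eLpNorm'] at h
  refine h.congr fun s => eLpNorm_congr_ae ?_
  have e : ∀ s : ℝ, Lp.compMeasurePreserving (c s) (hmp s) (hG.toLp G)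
      =ᵐ[volume] fun x => G (s + x) := fun s =>
    (Lp.coeFn_compMeasurePreserving _ (hmp s)).trans
      ((hmp s).quasiMeasurePreserving.ae_eq_comp hG.coeFn_toLp)
  filter_upwards [e s, e 0] with x h1 h2
  simp [h1, h2]

theorem eLpNorm_two_sq {α : Type*} [MeasurableSpace α] (μ : Measure α) (f : α → ℝ) :
    eLpNorm f 2 μ ^ 2 = ∫⁻ x, ‖f x‖ₑ ^ 2 ∂μ := by
  have := eLpNorm_nnreal_pow_eq_lintegral (f := f) (μ := μ) (p := 2) (by simp)
  simpa using this

/-- On a probability space the `L¹` norm is at most the `L²` norm. -/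
theorem enorm_integral_unit_sq_le {f : ℝ → ℝ} (hf : Measurable f) :
    ‖∫ σ in (0 : ℝ)..1, f σ‖ₑ ^ 2 ≤ ∫⁻ σ in Ioc (0 : ℝ) 1, ‖f σ‖ₑ ^ 2 := by
  rw [← eLpNorm_two_sq, intervalIntegral.integral_of_le zero_le_one]
  have : IsProbabilityMeasure (volume.restrict (Ioc (0 : ℝ) 1)) := ⟨by simp⟩
  gcongr
  refine (enorm_integral_le_lintegral_enorm _).trans ?_
  rw [← eLpNorm_one_eq_lintegral_enorm]
  exact eLpNorm_le_eLpNorm_of_exponent_le (by norm_num) hf.aestronglyMeasurable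

theorem MemLp.intervalIntegrable_of_two {G : ℝ → ℝ} (hG : MemLp G 2 volume) (a b : ℝ) :
    IntervalIntegrable G volume a b := by
  refine intervalIntegrable_iff.2 ?_
  have : IsFiniteMeasure (volume.restrict (uIoc a b)) := ⟨by simp [uIoc]⟩
  exact (hG.restrict _).integrable (by norm_num)

/-- Difference quotients of a primitive converge in `L²` to the integrand. -/
theorem tendsto_eLpNorm_average {G : ℝ → ℝ} (hm : Measurable G) (hG : MemLp G 2 volume) :
    Tendsto (fun h => eLpNorm (fun x => h⁻¹ * (∫ y in x..x + h, G y) - G x) 2 volume)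
      (𝓝[≠] 0) (𝓝 0) := by
  rw [ENNReal.tendsto_nhds_zero]
  intro ε hε
  have ht := (ENNReal.tendsto_nhds_zero.1 (tendsto_eLpNorm_translate hG)) ε hε
  obtain ⟨δ, hδ, hball⟩ := Metric.eventually_nhds_iff_ball.1 ht
  filter_upwards [self_mem_nhdsWithin, nhdsWithin_le_nhds (Metric.ball_mem_nhds 0 hδ)] with h h0 hh
  have h0 : h ≠ 0 := h0
  -- The substitution `y = x + hσ` turns the error into a mean over `σ ∈ [0,1]` of translation
  -- errors with shifts `hσ` no larger than `h`. Tonelli then reduces the claim to continuity of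
  -- translations.
  have e : ∀ x, h⁻¹ * (∫ y in x..x + h, G y) - G x
      = ∫ σ in (0 : ℝ)..1, (G (h * σ + x) - G x) := by
    intro x
    have hi : IntervalIntegrable (fun σ => G (h * σ + x)) volume 0 1 := by
      have := ((MemLp.intervalIntegrable_of_two hG x (h + x)).comp_add_right x).comp_mul_left
        (c := h)
      simpa [h0] using this
    rw [intervalIntegral.integral_sub hi (by simp)]
    rw [intervalIntegral.integral_comp_mul_add _ h0]
    simp [add_comm]
  have key : eLpNorm (fun x => h⁻¹ * (∫ y in x..x + h, G y) - G x) 2 volume ^ 2 ≤ ε ^ 2 := by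
    simp_rw [e]
    rw [eLpNorm_two_sq]
    calc ∫⁻ x, ‖∫ σ in (0 : ℝ)..1, (G (h * σ + x) - G x)‖ₑ ^ 2
        ≤ ∫⁻ x, ∫⁻ σ in Ioc (0 : ℝ) 1, ‖G (h * σ + x) - G x‖ₑ ^ 2 :=
          lintegral_mono fun x => enorm_integral_unit_sq_le (by fun_prop)
      _ = ∫⁻ σ in Ioc (0 : ℝ) 1, ∫⁻ x, ‖G (h * σ + x) - G x‖ₑ ^ 2 :=
          lintegral_lintegral_swap (by
            apply Measurable.aemeasurable
            unfold Function.uncurry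
            fun_prop)
      _ ≤ ∫⁻ σ in Ioc (0 : ℝ) 1, ε ^ 2 := by
          refine setLIntegral_mono measurable_const fun σ hσ => ?_
          rw [← eLpNorm_two_sq volume (fun x => G (h * σ + x) - G x)]
          gcongr
          apply hball
          rw [Metric.mem_ball, dist_zero_right] at hh ⊢
          refine lt_of_le_of_lt ?_ hh
          rw [norm_mul, Real.norm_eq_abs σ, abs_of_pos hσ.1]
          exact mul_le_of_le_one_right (norm_nonneg _) hσ.2
      _ = ε ^ 2 := by simp
  exact (ENNReal.pow_le_pow_left_iff two_ne_zero).1 key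

/-! ### Locally square-integrable profiles and the regularity of their states. -/

section

/-- Measurable functions that are square-integrable on bounded intervals. -/
structure LocL2 (G : ℝ → ℝ) : Prop where
  measurable : Measurable G
  memLp : ∀ a b : ℝ, MemLp G 2 (volume.restrict (Icc a b))

/-- Truncation carries results for global `L²` functions over to local ones. -/
theorem LocL2.cut {G : ℝ → ℝ} (hG : LocL2 G) (R : ℝ) :
    MemLp ((Icc (-R) R).indicator G) 2 volume :=
  (memLp_indicator_iff_restrict measurableSet_Icc).2 (hG.memLp _ _)

theorem LocL2.cut_measurable {G : ℝ → ℝ} (hG : LocL2 G) (R : ℝ) :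
    Measurable ((Icc (-R) R).indicator G) := hG.measurable.indicator measurableSet_Icc

theorem LocL2.intervalIntegrable {G : ℝ → ℝ} (hG : LocL2 G) (a b : ℝ) :
    IntervalIntegrable G volume a b := by
  refine intervalIntegrable_iff.2 ?_
  have : IsFiniteMeasure (volume.restrict (uIcc a b)) := ⟨by simp [uIcc]⟩
  exact IntegrableOn.mono_set ((hG.memLp _ _).integrable (by norm_num)) uIoc_subset_uIcc

theorem LocL2.neg_arg {G : ℝ → ℝ} (hG : LocL2 G) : LocL2 fun x => G (-x) := by
  refine ⟨hG.measurable.comp measurable_neg, fun a b => ?_⟩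
  have h := (Measure.measurePreserving_neg (volume : Measure ℝ)).restrict_preimage
    (measurableSet_Icc (a := -b) (b := -a))
  have h2 := (hG.memLp (-b) (-a)).comp_measurePreserving h
  have e : (Neg.neg : ℝ → ℝ) ⁻¹' Icc (-b) (-a) = Icc a b := by ext x; simp
  rw [e] at h2
  exact h2

/-- A measure-preserving change of variable that maps `(0,1)` into `[-R,R]`. -/
structure UnitChart (ρ : ℝ → ℝ) (R : ℝ) : Prop where
  mp : MeasurePreserving ρ volume volume
  mapsTo : ∀ x ∈ Ioo (0 : ℝ) 1, ρ x ∈ Icc (-R) R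

theorem unitChart_add (t : ℝ) : UnitChart (fun x => t + x) (|t| + 1) :=
  ⟨measurePreserving_add_left volume t, fun x hx => by
    have := neg_abs_le t; have := le_abs_self t
    constructor <;> linarith [hx.1, hx.2]⟩

theorem unitChart_sub (t : ℝ) : UnitChart (fun x => t - x) (|t| + 1) :=
  ⟨Measure.measurePreserving_sub_left volume t, fun x hx => by
    have := neg_abs_le t; have := le_abs_self t
    constructor <;> linarith [hx.1, hx.2]⟩

variable {G ρ : ℝ → ℝ} {R : ℝ}

theorem LocL2.memLp_comp (hG : LocL2 G) (hρ : UnitChart ρ R) :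
    MemLp (fun x => G (ρ x)) 2 spaceMeasure := by
  refine MemLp.ae_eq ?_ (((hG.cut R).comp_measurePreserving hρ.mp).restrict (Ioo 0 1))
  refine ae_spaceMeasure_iff.2 (.of_forall fun x hx => ?_)
  simp [indicator_of_mem (hρ.mapsTo x hx)]

/-- For `|h| < 1` both `ρ x` and `h + ρ x` stay in `[-(R + 1), R + 1]`, where `G` agrees with its
truncation. The measure-preserving chart then bounds the norm on `(0,1)` by the norm on the line. -/
theorem LocL2.tendsto_translate (hG : LocL2 G) (hρ : UnitChart ρ R) :
    Tendsto (fun h => eLpNorm (fun x => G (h + ρ x) - G (ρ x)) 2 spaceMeasure)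
      (𝓝 0) (𝓝 0) := by
  refine tendsto_of_tendsto_of_tendsto_of_le_of_le' tendsto_const_nhds
    (tendsto_eLpNorm_translate (hG.cut (R + 1))) (.of_forall fun _ => zero_le) ?_
  filter_upwards [Metric.ball_mem_nhds (0 : ℝ) one_pos] with h hh
  rw [Metric.mem_ball, dist_zero_right, Real.norm_eq_abs, abs_lt] at hh
  have hmp := eLpNorm_comp_measurePreserving (p := 2) (g := fun x =>
    (Icc (-(R + 1)) (R + 1)).indicator G (h + x) - (Icc (-(R + 1)) (R + 1)).indicator G x)
    (Measurable.aestronglyMeasurable (by have := hG.cut_measurable (R + 1); fun_prop)) hρ.mp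
  rw [← hmp]
  refine le_trans (le_of_eq (eLpNorm_congr_ae ?_)) (eLpNorm_mono_measure _ Measure.restrict_le_self)
  refine ae_spaceMeasure_iff.2 (.of_forall fun x hx => ?_)
  have hm := hρ.mapsTo x hx
  have h1 : ρ x ∈ Icc (-(R + 1)) (R + 1) := ⟨by linarith [hm.1], by linarith [hm.2]⟩
  have h2 : h + ρ x ∈ Icc (-(R + 1)) (R + 1) := ⟨by linarith [hm.1], by linarith [hm.2]⟩
  simp only [Function.comp_apply, indicator_of_mem h1, indicator_of_mem h2]

theorem LocL2.continuous_primitive (hG : LocL2 G) (a : ℝ) :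
    Continuous fun x => ∫ y in a..x, G y :=
  intervalIntegral.continuous_primitive (fun a b => hG.intervalIntegrable a b) a

theorem LocL2.measurable_integral_window (hG : LocL2 G) (h : ℝ) :
    Measurable fun x => ∫ y in x..x + h, G y := by
  have e : (fun x => ∫ y in x..x + h, G y)
      = fun x => (∫ y in (0 : ℝ)..x + h, G y) - ∫ y in (0 : ℝ)..x, G y := by
    funext x
    rw [intervalIntegral.integral_interval_sub_left] <;> exact hG.intervalIntegrable _ _
  rw [e]
  have := (hG.continuous_primitive 0)
  exact ((this.comp (continuous_id.add continuous_const)).sub this).measurable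

theorem LocL2.of_memLp (hm : Measurable G) (h : MemLp G 2 volume) : LocL2 G :=
  ⟨hm, fun _ _ => h.restrict _⟩

theorem LocL2.tendsto_average (hG : LocL2 G) (hρ : UnitChart ρ R) :
    Tendsto (fun h => eLpNorm (fun x => h⁻¹ * (∫ y in ρ x..ρ x + h, G y) - G (ρ x)) 2 spaceMeasure)
      (𝓝[≠] 0) (𝓝 0) := by
  have hloc := LocL2.of_memLp (hG.cut_measurable (R + 1)) (hG.cut (R + 1))
  refine tendsto_of_tendsto_of_tendsto_of_le_of_le' tendsto_const_nhds
    (tendsto_eLpNorm_average (hG.cut_measurable (R + 1)) (hG.cut (R + 1)))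
    (.of_forall fun _ => zero_le) ?_
  filter_upwards [nhdsWithin_le_nhds (Metric.ball_mem_nhds (0 : ℝ) one_pos)] with h hh
  rw [Metric.mem_ball, dist_zero_right, Real.norm_eq_abs, abs_lt] at hh
  have hmp := eLpNorm_comp_measurePreserving (p := 2) (g := fun x =>
    h⁻¹ * (∫ y in x..x + h, (Icc (-(R + 1)) (R + 1)).indicator G y)
      - (Icc (-(R + 1)) (R + 1)).indicator G x)
    (Measurable.aestronglyMeasurable (by
      have := hloc.measurable_integral_window h
      have := hG.cut_measurable (R + 1); fun_prop)) hρ.mp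
  rw [← hmp]
  refine le_trans (le_of_eq (eLpNorm_congr_ae ?_)) (eLpNorm_mono_measure _ Measure.restrict_le_self)
  refine ae_spaceMeasure_iff.2 (.of_forall fun x hx => ?_)
  have hm := hρ.mapsTo x hx
  have h1 : ρ x ∈ Icc (-(R + 1)) (R + 1) := ⟨by linarith [hm.1], by linarith [hm.2]⟩
  have h2 : ρ x + h ∈ Icc (-(R + 1)) (R + 1) := ⟨by linarith [hm.1], by linarith [hm.2]⟩
  have e : ∫ y in ρ x..ρ x + h, (Icc (-(R + 1)) (R + 1)).indicator G y
      = ∫ y in ρ x..ρ x + h, G y := by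
    refine intervalIntegral.integral_congr fun y hy => ?_
    have : uIcc (ρ x) (ρ x + h) ⊆ Icc (-(R + 1)) (R + 1) := by
      have hR : -(R + 1) ≤ R + 1 := h1.1.trans h1.2
      rw [← uIcc_of_le hR] at h1 h2 ⊢
      exact uIcc_subset_uIcc h1 h2
    exact indicator_of_mem (this hy) G
  simp only [Function.comp_apply, indicator_of_mem h1, e]

/-- The position generated by the profile `G`. -/
noncomputable def posOf (G : ℝ → ℝ) (t x : ℝ) : ℝ := ∫ s in (0 : ℝ)..x, (G (t + s) + G (t - s))

/-- The velocity generated by the profile `G`. -/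
def velOf (G : ℝ → ℝ) (t x : ℝ) : ℝ := G (t + x) - G (t - x)

/-- The boundary control corresponding to the profile `G`. -/
def ctrlOf (G : ℝ → ℝ) (t : ℝ) : ℝ := G (t + 1) + G (t - 1)

theorem LocL2.intervalIntegrable_add (hG : LocL2 G) (t a b : ℝ) :
    IntervalIntegrable (fun s => G (t + s)) volume a b := by
  have := (hG.intervalIntegrable (t + a) (t + b)).comp_add_left t
  simpa using this

theorem LocL2.intervalIntegrable_sub (hG : LocL2 G) (t a b : ℝ) :
    IntervalIntegrable (fun s => G (t - s)) volume a b := by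
  have := (hG.intervalIntegrable (t - a) (t - b)).comp_sub_left t
  simpa using this

theorem LocL2.posOf_eq (hG : LocL2 G) (t x : ℝ) : posOf G t x = ∫ y in (t - x)..(t + x), G y := by
  rw [posOf, intervalIntegral.integral_add (hG.intervalIntegrable_add _ _ _)
    (hG.intervalIntegrable_sub _ _ _), intervalIntegral.integral_comp_add_left,
    intervalIntegral.integral_comp_sub_left, add_comm, add_zero, sub_zero]
  exact intervalIntegral.integral_add_adjacent_intervals (hG.intervalIntegrable _ _)
    (hG.intervalIntegrable _ _)

theorem deriv_integral_ae {f : ℝ → ℝ} (hf : IntervalIntegrable f volume 0 1) (c : ℝ) :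
    deriv (fun x => c + ∫ s in (0 : ℝ)..x, f s) =ᵐ[spaceMeasure] f := by
  refine ae_spaceMeasure_iff.2 ?_
  filter_upwards [hf.ae_hasDerivAt_integral] with x hx hxm
  rw [uIcc_of_le zero_le_one] at hx
  exact ((hx (Ioo_subset_Icc_self hxm) 0 ⟨le_rfl, zero_le_one⟩).const_add c).deriv

theorem LocL2.deriv_posOf (hG : LocL2 G) (t : ℝ) :
    deriv (posOf G t) =ᵐ[spaceMeasure] fun x => G (t + x) + G (t - x) := by
  have := deriv_integral_ae ((hG.intervalIntegrable_add t 0 1).add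
    (hG.intervalIntegrable_sub t 0 1)) 0
  simp only [zero_add] at this
  exact this

theorem LocL2.memLp_add (hG : LocL2 G) (t : ℝ) : MemLp (fun x => G (t + x)) 2 spaceMeasure :=
  hG.memLp_comp (unitChart_add t)

theorem LocL2.memLp_sub (hG : LocL2 G) (t : ℝ) : MemLp (fun x => G (t - x)) 2 spaceMeasure :=
  hG.memLp_comp (unitChart_sub t)

theorem LocL2.memH1_posOf (hG : LocL2 G) (t : ℝ) : MemH1 (posOf G t) := by
  constructor
  · exact ((hG.intervalIntegrable_add t 0 1).add
      (hG.intervalIntegrable_sub t 0 1)).absolutelyContinuousOnInterval_intervalIntegral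
      left_mem_uIcc
  · exact (memLp_congr_ae (hG.deriv_posOf t)).2 ((hG.memLp_add t).add (hG.memLp_sub t))

theorem tendsto_sub_nhds_zero (S : Set ℝ) (t : ℝ) : Tendsto (fun s => s - t) (𝓝[S] t) (𝓝 0) := by
  have : Tendsto (fun s : ℝ => s - t) (𝓝 t) (𝓝 (t - t)) := tendsto_id.sub_const t
  rw [sub_self] at this
  exact this.mono_left nhdsWithin_le_nhds

/-- The triangle inequality for either sign: space derivatives are sums of the two travelling waves,
velocities are differences. -/
theorem tendsto_eLpNorm_of_le_add {α ι : Type*} [MeasurableSpace α] {μ : Measure α} {l : Filter ι}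
    {w f g : ι → α → ℝ} (hw : ∀ᶠ i in l, w i =ᵐ[μ] f i + g i ∨ w i =ᵐ[μ] f i - g i)
    (hf : ∀ i, AEStronglyMeasurable (f i) μ) (hg : ∀ i, AEStronglyMeasurable (g i) μ)
    (hf0 : Tendsto (fun i => eLpNorm (f i) 2 μ) l (𝓝 0))
    (hg0 : Tendsto (fun i => eLpNorm (g i) 2 μ) l (𝓝 0)) :
    Tendsto (fun i => eLpNorm (w i) 2 μ) l (𝓝 0) := by
  have hadd := hf0.add hg0
  rw [add_zero] at hadd
  refine tendsto_of_tendsto_of_tendsto_of_le_of_le' tendsto_const_nhds hadd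
    (.of_forall fun _ => zero_le) ?_
  filter_upwards [hw] with i hi
  rcases hi with hi | hi
  · rw [eLpNorm_congr_ae hi]
    exact eLpNorm_add_le (hf i) (hg i) (by norm_num)
  · rw [eLpNorm_congr_ae hi]
    exact eLpNorm_sub_le (hf i) (hg i) (by norm_num)

theorem LocL2.tendsto_add (hG : LocL2 G) (S : Set ℝ) (t : ℝ) :
    Tendsto (fun s => eLpNorm (fun x => G (s + x) - G (t + x)) 2 spaceMeasure) (𝓝[S] t) (𝓝 0) := by
  refine ((hG.tendsto_translate (unitChart_add t)).comp (tendsto_sub_nhds_zero S t)).congr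
    fun s => ?_
  simp [← add_assoc]

theorem LocL2.tendsto_sub (hG : LocL2 G) (S : Set ℝ) (t : ℝ) :
    Tendsto (fun s => eLpNorm (fun x => G (s - x) - G (t - x)) 2 spaceMeasure) (𝓝[S] t) (𝓝 0) := by
  refine ((hG.tendsto_translate (unitChart_sub t)).comp (tendsto_sub_nhds_zero S t)).congr
    fun s => ?_
  simp

theorem LocL2.continuousIntoL2_vel (hG : LocL2 G) (S : Set ℝ) : ContinuousIntoL2 S (velOf G) := by
  have hm := hG.measurable
  refine ⟨fun t _ => (hG.memLp_add t).sub (hG.memLp_sub t), fun t _ => ?_⟩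
  refine tendsto_eLpNorm_of_le_add (.of_forall fun s => Or.inr (.of_forall fun x => ?_))
    (fun s => ?_) (fun s => ?_) (hG.tendsto_add S t) (hG.tendsto_sub S t)
  · simp [velOf]; ring
  · exact Measurable.aestronglyMeasurable (by fun_prop)
  · exact Measurable.aestronglyMeasurable (by fun_prop)

theorem LocL2.continuousIntoL2_deriv (hG : LocL2 G) (S : Set ℝ) :
    ContinuousIntoL2 S (fun t => deriv (posOf G t)) := by
  have hm := hG.measurable
  refine ⟨fun t _ => (hG.memH1_posOf t).2, fun t _ => ?_⟩
  refine tendsto_eLpNorm_of_le_add (.of_forall fun s => Or.inl ?_)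
    (fun s => ?_) (fun s => ?_) (hG.tendsto_add S t) (hG.tendsto_sub S t)
  · filter_upwards [hG.deriv_posOf s, hG.deriv_posOf t] with x h1 h2
    simp [h1, h2]; ring
  · exact Measurable.aestronglyMeasurable (by fun_prop)
  · exact Measurable.aestronglyMeasurable (by fun_prop)

/-- The position is the integral of `G` over the window `[t - x, t + x]`. Moving the window by `s -
t` changes it by the integrals over two short intervals at its ends, so the difference quotient is a
difference of two averages. -/
theorem LocL2.hasTimeDerivL2 (hG : LocL2 G) (S : Set ℝ) :
    HasTimeDerivL2 S (posOf G) (velOf G) := by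
  have hm := hG.measurable
  intro t _
  have hl : Tendsto (fun s => s - t) (𝓝[S \ {t}] t) (𝓝[≠] 0) := by
    refine tendsto_nhdsWithin_iff.2 ⟨tendsto_sub_nhds_zero _ t, ?_⟩
    filter_upwards [self_mem_nhdsWithin] with s hs
    exact sub_ne_zero.2 hs.2
  have hmw := fun h : ℝ => hG.measurable_integral_window h
  refine tendsto_eLpNorm_of_le_add (.of_forall fun s => Or.inr (.of_forall fun x => ?_))
    (fun s => ?_) (fun s => ?_) ((hG.tendsto_average (unitChart_add t)).comp hl)
    ((hG.tendsto_average (unitChart_sub t)).comp hl)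
  · have hi := hG.intervalIntegrable
    simp only [hG.posOf_eq, velOf, Pi.sub_apply]
    have e1 : t + x + (s - t) = s + x := by ring
    have e2 : t - x + (s - t) = s - x := by ring
    rw [e1, e2]
    have h1 := intervalIntegral.integral_interval_sub_interval_comm (hi (s - x) (s + x))
      (hi (t - x) (t + x)) (hi (s - x) (t - x))
    rw [h1, intervalIntegral.integral_symm (t - x) (s - x),
      intervalIntegral.integral_symm (t + x) (s + x)]
    ring
  · have := (hmw (s - t)).comp (measurable_const_add t)
    exact Measurable.aestronglyMeasurable
      ((this.const_mul _).sub (hm.comp (measurable_const_add t)))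
  · have := (hmw (s - t)).comp (measurable_const.sub measurable_id : Measurable fun x : ℝ => t - x)
    exact Measurable.aestronglyMeasurable
      ((this.const_mul _).sub (hm.comp (measurable_const.sub measurable_id)))

/-- Differentiability of the path in `L²` already gives continuity. -/
theorem LocL2.continuousIntoL2_pos (hG : LocL2 G) (S : Set ℝ) : ContinuousIntoL2 S (posOf G) := by
  refine ⟨fun t _ => (hG.memH1_posOf t).memLp, fun t ht => ?_⟩
  have hv := (hG.continuousIntoL2_vel S).1
  have h := (HasTimeDerivL2.hasDerivWithinAt (hG.hasTimeDerivL2 S)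
    (fun t _ => (hG.memH1_posOf t).memLp) hv ht).continuousWithinAt
  rw [ContinuousWithinAt, Lp.tendsto_Lp_iff_tendsto_eLpNorm'] at h
  refine h.congr fun s => eLpNorm_congr_ae ?_
  filter_upwards [l2Path_coeFn (hG.memH1_posOf s).memLp, l2Path_coeFn (hG.memH1_posOf t).memLp]
    with x h1 h2
  simp [h1, h2]

end

/-! ### Green's formula, and the solution generated by a profile. -/

section

variable {G : ℝ → ℝ}

theorem integrable_mul_of_memLp {α : Type*} [MeasurableSpace α] {μ : Measure α} {f g : α → ℝ}
    (hf : MemLp f 2 μ) (hg : MemLp g 2 μ) : Integrable (fun x => f x * g x) μ :=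
  hf.integrable_mul hg

/-- Only arguments in a bounded interval occur, so `G` may be truncated and the integrand becomes
that of a convolution of integrable functions. This licenses Fubini in Green's formula. -/
theorem LocL2.integrable_convolution (hG : LocL2 G) {ψ : ℝ → ℝ} (hψ : MemLp ψ 2 spaceMeasure)
    (a b : ℝ) : Integrable (Function.uncurry fun s x => G (s - x) * ψ x)
      ((volume.restrict (uIoc a b)).prod spaceMeasure) := by
  set R := |a| + |b| + 1 with hR
  have hcut : Integrable ((Icc (-R) R).indicator G) volume := by
    refine (integrable_indicator_iff measurableSet_Icc).2 ?_
    have : IsFiniteMeasure (volume.restrict (Icc (-R) R)) := ⟨by simp⟩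
    exact (hG.memLp _ _).integrable (by norm_num)
  have h := Integrable.convolution_integrand (μ := volume) (ν := spaceMeasure)
    (ContinuousLinearMap.mul ℝ ℝ) (hψ.integrable (by norm_num)) hcut
  have h2 := h.restrict (s := uIoc a b ×ˢ univ)
  rw [← Measure.prod_restrict, Measure.restrict_univ] at h2
  refine h2.congr ?_
  rw [spaceMeasure, Measure.prod_restrict]
  filter_upwards [ae_restrict_mem (measurableSet_uIoc.prod measurableSet_Ioo)] with p hp
  have h1 : p.1 - p.2 ∈ Icc (-R) R := by
    have ha := neg_abs_le a
    have ha' := le_abs_self a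
    have hb := neg_abs_le b
    have hb' := le_abs_self b
    have na := abs_nonneg a
    have nb := abs_nonneg b
    obtain ⟨h1, h2⟩ := hp
    rcases mem_uIoc.1 h1 with h1 | h1 <;> constructor <;> linarith [h1.1, h1.2, h2.1, h2.2]
  simp only [ContinuousLinearMap.mul_apply', indicator_of_mem h1, Function.uncurry]
  ring

/-- The function `P x = ∫₀ᵗ G (s - x) ds` is absolutely continuous with derivative `G (-x) - G (t -
x)`. Integrating `P * deriv φ` by parts and exchanging the integrals gives the formula, although `G`
itself has no derivative. -/
theorem LocL2.green_left (hG : LocL2 G) {φ : ℝ → ℝ} (hφ : MemH1 φ) (t : ℝ) :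
    (∫ x in (0 : ℝ)..1, G (t - x) * φ x) - (∫ x in (0 : ℝ)..1, G (-x) * φ x)
      = (∫ s in (0 : ℝ)..t, ∫ x in (0 : ℝ)..1, G (s - x) * deriv φ x)
        - φ 1 * (∫ s in (0 : ℝ)..t, G (s - 1)) + φ 0 * ∫ s in (0 : ℝ)..t, G s := by
  have hi := hG.intervalIntegrable
  have hneg : ∀ a b, IntervalIntegrable (fun s => G (-s)) volume a b :=
    hG.neg_arg.intervalIntegrable
  have hsub := hG.intervalIntegrable_sub t
  set P : ℝ → ℝ := fun x => (∫ s in (0 : ℝ)..t, G s) + ∫ s in (0 : ℝ)..x, (G (-s) - G (t - s))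
    with hP
  have hPeq : ∀ x, P x = ∫ s in (0 : ℝ)..t, G (s - x) := by
    intro x
    rw [hP]
    simp only
    rw [intervalIntegral.integral_sub (hneg _ _) (hsub _ _),
      intervalIntegral.integral_comp_sub_left, intervalIntegral.integral_comp_neg,
      intervalIntegral.integral_comp_sub_right, zero_sub, sub_zero, neg_zero]
    have e1 := intervalIntegral.integral_add_adjacent_intervals (hi (-x) 0) (hi 0 (t - x))
    have e2 := intervalIntegral.integral_add_adjacent_intervals (hi 0 (t - x)) (hi (t - x) t)
    linarith
  have hq : IntervalIntegrable (fun s => G (-s) - G (t - s)) volume 0 1 := (hneg _ _).sub (hsub _ _)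
  have hPac : AbsolutelyContinuousOnInterval P 0 1 :=
    (memH1_const _).1.add (hq.absolutelyContinuousOnInterval_intervalIntegral left_mem_uIcc)
  have hparts := hPac.integral_mul_deriv_eq_deriv_mul hφ.1
  have e1 : ∫ x in (0 : ℝ)..1, deriv P x * φ x
      = (∫ x in (0 : ℝ)..1, G (-x) * φ x) - ∫ x in (0 : ℝ)..1, G (t - x) * φ x := by
    have hm1 : Integrable (fun x => G (-x) * φ x) spaceMeasure := by
      have := integrable_mul_of_memLp (hG.memLp_sub 0) hφ.memLp
      simpa only [zero_sub] using this
    have hm2 : Integrable (fun x => G (t - x) * φ x) spaceMeasure :=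
      integrable_mul_of_memLp (hG.memLp_sub t) hφ.memLp
    rw [integral_zero_one_eq, integral_zero_one_eq, integral_zero_one_eq, ← integral_sub hm1 hm2]
    apply integral_congr_ae
    filter_upwards [deriv_integral_ae hq (∫ s in (0 : ℝ)..t, G s)] with x hx
    rw [hP, hx]
    ring
  have e2 : ∫ x in (0 : ℝ)..1, P x * deriv φ x
      = ∫ s in (0 : ℝ)..t, ∫ x in (0 : ℝ)..1, G (s - x) * deriv φ x := by
    simp_rw [integral_zero_one_eq]
    rw [intervalIntegral_integral_swap (hG.integrable_convolution hφ.2 0 t)]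
    simp_rw [intervalIntegral.integral_mul_const, ← hPeq]
  rw [e1, e2, hPeq, hPeq] at hparts
  simp only [sub_zero] at hparts
  linarith

/-- The left-hand version for the reflected profile, at time `-t`. -/
theorem LocL2.green_right (hG : LocL2 G) {φ : ℝ → ℝ} (hφ : MemH1 φ) (t : ℝ) :
    (∫ x in (0 : ℝ)..1, G (t + x) * φ x) - (∫ x in (0 : ℝ)..1, G x * φ x)
      = -(∫ s in (0 : ℝ)..t, ∫ x in (0 : ℝ)..1, G (s + x) * deriv φ x)
        + φ 1 * (∫ s in (0 : ℝ)..t, G (s + 1)) - φ 0 * ∫ s in (0 : ℝ)..t, G s := by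
  have h := hG.neg_arg.green_left hφ (-t)
  have r : ∀ f : ℝ → ℝ, ∫ s in (0 : ℝ)..(-t), f (-s) = -∫ s in (0 : ℝ)..t, f s := by
    intro f
    rw [intervalIntegral.integral_comp_neg, neg_neg, neg_zero, intervalIntegral.integral_symm]
  have r1 := r fun s => ∫ x in (0 : ℝ)..1, G (s + x) * deriv φ x
  have r2 := r fun s => G (s + 1)
  have r3 := r G
  have e1 : ∀ s x : ℝ, -(s - x) = -s + x := fun s x => by ring
  simp only [e1, neg_neg] at h
  rw [r1, r2, r3] at h
  linarith

theorem continuous_pairing {ψ : ℝ → ℝ} (hψ : MemLp ψ 2 spaceMeasure)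
    {e : ℝ → ℝ → ℝ} (he : ∀ S, ContinuousIntoL2 S e) :
    Continuous fun s => ∫ x in (0 : ℝ)..1, e s x * ψ x := by
  have h := (he univ).continuousOn
  rw [continuousOn_univ] at h
  have : (fun s => ∫ x in (0 : ℝ)..1, e s x * ψ x)
      = fun s => inner ℝ (l2Path e s) (hψ.toLp ψ) := by
    funext s
    exact integral_mul_eq_inner (l2Path_coeFn ((he univ).1 s (mem_univ s))) hψ.coeFn_toLp
  rw [this]
  exact h.inner continuous_const

theorem LocL2.continuousIntoL2_add (hG : LocL2 G) (S : Set ℝ) :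
    ContinuousIntoL2 S (fun s x => G (s + x)) :=
  ⟨fun t _ => hG.memLp_add t, fun t _ => hG.tendsto_add S t⟩

theorem LocL2.continuousIntoL2_sub (hG : LocL2 G) (S : Set ℝ) :
    ContinuousIntoL2 S (fun s x => G (s - x)) :=
  ⟨fun t _ => hG.memLp_sub t, fun t _ => hG.tendsto_sub S t⟩

/-- Green's formula for the d'Alembert solution with profile `G`. -/
theorem LocL2.green (hG : LocL2 G) {φ : ℝ → ℝ} (hφ : MemH1 φ) (t : ℝ) :
    (∫ x in (0 : ℝ)..1, velOf G t x * φ x) - (∫ x in (0 : ℝ)..1, velOf G 0 x * φ x)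
        + (∫ s in (0 : ℝ)..t, ∫ x in (0 : ℝ)..1, deriv (posOf G s) x * deriv φ x)
      = (∫ s in (0 : ℝ)..t, ctrlOf G s) * φ 1 - (∫ s in (0 : ℝ)..t, 2 * G s) * φ 0 := by
  have hvel : ∀ t, ∫ x in (0 : ℝ)..1, velOf G t x * φ x
      = (∫ x in (0 : ℝ)..1, G (t + x) * φ x) - ∫ x in (0 : ℝ)..1, G (t - x) * φ x := by
    intro t
    simp_rw [integral_zero_one_eq]
    rw [← integral_sub (integrable_mul_of_memLp (hG.memLp_add t) hφ.memLp)
      (integrable_mul_of_memLp (hG.memLp_sub t) hφ.memLp)]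
    simp only [velOf, sub_mul]
  have hder : ∀ s, ∫ x in (0 : ℝ)..1, deriv (posOf G s) x * deriv φ x
      = (∫ x in (0 : ℝ)..1, G (s + x) * deriv φ x)
        + ∫ x in (0 : ℝ)..1, G (s - x) * deriv φ x := by
    intro s
    simp_rw [integral_zero_one_eq]
    rw [← integral_add (integrable_mul_of_memLp (hG.memLp_add s) hφ.2)
      (integrable_mul_of_memLp (hG.memLp_sub s) hφ.2)]
    apply integral_congr_ae
    filter_upwards [hG.deriv_posOf s] with x hx
    rw [hx, add_mul]
  have hctrl : ∫ s in (0 : ℝ)..t, ctrlOf G s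
      = (∫ s in (0 : ℝ)..t, G (s + 1)) + ∫ s in (0 : ℝ)..t, G (s - 1) := by
    unfold ctrlOf
    apply intervalIntegral.integral_add
    · have := hG.intervalIntegrable_add 1 0 t
      simpa only [add_comm] using this
    · have := (hG.intervalIntegrable (0 - 1) (t - 1)).comp_sub_right 1
      simpa using this
  have hsum : (∫ s in (0 : ℝ)..t, ∫ x in (0 : ℝ)..1, deriv (posOf G s) x * deriv φ x)
      = (∫ s in (0 : ℝ)..t, ∫ x in (0 : ℝ)..1, G (s + x) * deriv φ x)
        + ∫ s in (0 : ℝ)..t, ∫ x in (0 : ℝ)..1, G (s - x) * deriv φ x := by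
    simp_rw [hder]
    exact intervalIntegral.integral_add
      ((continuous_pairing hφ.2 hG.continuousIntoL2_add).intervalIntegrable _ _)
      ((continuous_pairing hφ.2 hG.continuousIntoL2_sub).intervalIntegrable _ _)
  have h1 := hG.green_left hφ t
  have h2 := hG.green_right hφ t
  rw [hvel, hvel, hsum, hctrl, intervalIntegral.integral_const_mul]
  simp only [zero_add, zero_sub]
  linarith

/-- `G` extends the initial profile. -/
def ExtendsData (y₀ y₁ G : ℝ → ℝ) : Prop := ∀ᵐ x, x ∈ Ioo (-1 : ℝ) 1 → G x = F y₀ y₁ x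

variable {y₀ y₁ u : ℝ → ℝ} {T : ℝ≥0∞}

theorem ExtendsData.ae_right (h : ExtendsData y₀ y₁ G) :
    ∀ᵐ x ∂spaceMeasure, G x = (1 / 2) * (deriv y₀ x + y₁ x) := by
  refine ae_spaceMeasure_iff.2 ?_
  filter_upwards [h] with x hx hxm
  rw [hx ⟨by linarith [hxm.1], hxm.2⟩, F, if_neg (not_lt.2 hxm.1.le)]

theorem ExtendsData.ae_left (h : ExtendsData y₀ y₁ G) :
    ∀ᵐ x ∂spaceMeasure, G (-x) = (1 / 2) * (deriv y₀ x - y₁ x) := by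
  refine ae_spaceMeasure_iff.2 ?_
  have hn := (Measure.measurePreserving_neg (volume : Measure ℝ)).quasiMeasurePreserving.ae h
  filter_upwards [hn] with x hx hxm
  rw [hx ⟨by linarith [hxm.2], by linarith [hxm.1]⟩, F, if_pos (by linarith [hxm.1]), neg_neg]

theorem ExtendsData.velOf_zero (h : ExtendsData y₀ y₁ G) :
    velOf G 0 =ᵐ[spaceMeasure] y₁ := by
  filter_upwards [h.ae_right, h.ae_left] with x h1 h2
  rw [velOf, zero_add, zero_sub, h1, h2]; ring

theorem ExtendsData.posOf_zero (h : ExtendsData y₀ y₁ G) (hd : IsInitialData y₀ y₁)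
    {x : ℝ} (hx : x ∈ Icc (0 : ℝ) 1) : posOf G 0 x = y₀ x := by
  have hac : AbsolutelyContinuousOnInterval y₀ 0 x := hd.pos_memH1.1.mono (by
    rw [uIcc_of_le hx.1, uIcc_of_le zero_le_one]; exact Icc_subset_Icc_right hx.2)
  have e := hac.integral_deriv_eq_sub
  rw [hd.pos_zero, sub_zero] at e
  rw [posOf, ← e]
  apply intervalIntegral.integral_congr_ae
  have h1 := ae_spaceMeasure_iff.1 h.ae_right
  have h2 := ae_spaceMeasure_iff.1 h.ae_left
  filter_upwards [h1, h2, Measure.ae_ne volume (1 : ℝ)] with s h1 h2 hs hsm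
  rw [uIoc_of_le hx.1] at hsm
  have hs' : s ∈ Ioo (0 : ℝ) 1 := ⟨hsm.1, lt_of_le_of_ne (hsm.2.trans hx.2) hs⟩
  rw [zero_add, zero_sub, h1 hs', h2 hs']
  ring

theorem integral_congr_timeInterval {f g : ℝ → ℝ} (h : ∀ᵐ t, t ∈ timeInterval T → f t = g t)
    {t : ℝ} (ht : t ∈ timeInterval T) : ∫ s in (0 : ℝ)..t, f s = ∫ s in (0 : ℝ)..t, g s := by
  apply intervalIntegral.integral_congr_ae
  filter_upwards [h] with s hs hsm
  rw [uIoc_of_le ht.1] at hsm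
  exact hs (timeInterval_Icc_subset ht ⟨hsm.1.le, hsm.2⟩)

theorem integral_mul_congr_right {f g φ : ℝ → ℝ} (h : f =ᵐ[spaceMeasure] g) :
    ∫ x in (0 : ℝ)..1, f x * φ x = ∫ x in (0 : ℝ)..1, g x * φ x := by
  rw [integral_zero_one_eq, integral_zero_one_eq]
  apply integral_congr_ae
  filter_upwards [h] with x hx
  rw [hx]

theorem LocL2.isSolution (hG : LocL2 G) (hd : IsInitialData y₀ y₁) (hF : ExtendsData y₀ y₁ G)
    (hu : ∀ᵐ t, t ∈ timeInterval T → u t = ctrlOf G t) :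
    IsSolution T y₀ y₁ u (posOf G) (velOf G) where
  memH1 t _ := hG.memH1_posOf t
  continuous_pos := hG.continuousIntoL2_pos _
  continuous_space_deriv := hG.continuousIntoL2_deriv _
  hasTimeDeriv := hG.hasTimeDerivL2 _
  continuous_vel := hG.continuousIntoL2_vel _
  initial_pos _ hx := hF.posOf_zero hd hx
  initial_vel := hF.velOf_zero
  dirichlet t _ := by simp [posOf]
  weak φ hφ h0 t ht := by
    have := hG.green hφ t
    rw [h0, mul_zero, sub_zero, integral_mul_congr_right hF.velOf_zero] at this
    rw [this, integral_congr_timeInterval hu ht]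

theorem LocL2.isTrace (hG : LocL2 G) (hF : ExtendsData y₀ y₁ G)
    (hu : ∀ᵐ t, t ∈ timeInterval T → u t = ctrlOf G t) :
    IsNeumannTraceAtZero T y₁ u (posOf G) (velOf G) (fun t => 2 * G t) where
  memLp t _ := ((hG.memLp 0 t).mono_measure (Measure.restrict_mono Ioc_subset_Icc_self le_rfl)
    |>.const_mul 2)
  green φ hφ t ht := by
    have := hG.green hφ t
    rw [integral_mul_congr_right hF.velOf_zero] at this
    rw [this, integral_congr_timeInterval hu ht]

/-- With the constant test function `1` the interior term of Green's formula drops out. Velocity and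
control then determine the primitive of the trace. -/
theorem LocL2.trace_unique (hG : LocL2 G) (hT : 2 ≤ T) (hd : IsInitialData y₀ y₁)
    (hF : ExtendsData y₀ y₁ G) (hu : ∀ᵐ t, t ∈ timeInterval T → u t = ctrlOf G t)
    {y v : ℝ → ℝ → ℝ} {g : ℝ → ℝ} (hs : IsSolution T y₀ y₁ u y v)
    (hg : IsNeumannTraceAtZero T y₁ u y v g) : ∀ᵐ t, t ∈ timeInterval T → g t = 2 * G t := by
  have hs' := hG.isSolution hd hF hu
  have hg' := hG.isTrace hF hu
  have hii : ∀ {y v g}, IsNeumannTraceAtZero T y₁ u y v g → ∀ t ∈ timeInterval T,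
      IntegrableOn g (Ioc 0 t) := by
    intro y v g h t ht
    have : IsFiniteMeasure (volume.restrict (Ioc (0 : ℝ) t)) := ⟨by simp⟩
    exact (h.memLp t ht).integrable (by norm_num)
  have := ae_eq_zero_of_integral_eq_zero (f := fun t => g t - 2 * G t) (S := timeInterval T)
    (fun t ht => ht.1) (fun t ht => timeInterval_Icc_subset ht)
    (fun t ht => (hii hg t ht).sub (hii hg' t ht)) ?_
  · filter_upwards [this] with t ht htm
    exact sub_eq_zero.1 (ht htm)
  · intro t ht
    have e := hg.green _ (memH1_const 1) t ht
    have e' := hg'.green _ (memH1_const 1) t ht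
    rw [integral_mul_congr_right (hs.vel_eq hT hs' (fun _ _ => rfl) ht)] at e
    have hc : ∀ f : ℝ → ℝ → ℝ, ∫ s in (0 : ℝ)..t, ∫ x in (0 : ℝ)..1,
        f s x * deriv (fun _ : ℝ => (1 : ℝ)) x = 0 := by simp
    rw [hc] at e e'
    rw [intervalIntegral.integral_sub]
    · linarith
    · exact (intervalIntegrable_iff_integrableOn_Ioc_of_le ht.1).2 (hii hg t ht)
    · exact (intervalIntegrable_iff_integrableOn_Ioc_of_le ht.1).2 (hii hg' t ht)

end

/-! ### The correspondence between feasible controls and profiles. -/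

section

variable {G : ℝ → ℝ} {y₀ y₁ : ℝ → ℝ} {T : ℝ≥0∞}

theorem ae_comp_add {p : ℝ → Prop} (h : ∀ᵐ x, p x) (c : ℝ) : ∀ᵐ x, p (x + c) :=
  (measurePreserving_add_right volume c).quasiMeasurePreserving.ae h

theorem ae_comp_sub {p : ℝ → Prop} (h : ∀ᵐ x, p x) (c : ℝ) : ∀ᵐ x, p (x - c) :=
  (measurePreserving_sub_right volume c).quasiMeasurePreserving.ae h

theorem ae_comp_sub_left {p : ℝ → Prop} (h : ∀ᵐ x, p x) (c : ℝ) : ∀ᵐ x, p (c - x) :=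
  (Measure.measurePreserving_sub_left volume c).quasiMeasurePreserving.ae h

theorem measurableSet_timeInterval (T : ℝ≥0∞) : MeasurableSet (timeInterval T) :=
  (measurableSet_le measurable_const measurable_id).inter
    (measurableSet_le ENNReal.measurable_ofReal measurable_const)

theorem timeInterval_top : timeInterval ∞ = Ici 0 := by ext; simp [timeInterval]

theorem timeInterval_of_ne_top (hT : T ≠ ∞) : timeInterval T = Icc 0 T.toReal := by
  ext t
  simp [timeInterval, ENNReal.ofReal_le_iff_le_toReal hT]

/-- A measurable representative of the initial profile, extended by zero. -/
theorem IsInitialData.exists_profile (hd : IsInitialData y₀ y₁) :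
    ∃ Φ : ℝ → ℝ, Measurable Φ ∧ MemLp Φ 2 volume ∧ (∀ x, x ∉ Ioo (-1 : ℝ) 1 → Φ x = 0) ∧
      ExtendsData y₀ y₁ Φ := by
  -- The velocity datum is only almost everywhere measurable, whereas a profile has to be
  -- measurable.
  set z := hd.vel_memLp.aestronglyMeasurable.mk y₁ with hz
  have hzm : Measurable z := hd.vel_memLp.aestronglyMeasurable.stronglyMeasurable_mk.measurable
  have hzae : y₁ =ᵐ[spaceMeasure] z := hd.vel_memLp.aestronglyMeasurable.ae_eq_mk
  have hzL : MemLp z 2 spaceMeasure := hd.vel_memLp.ae_eq hzae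
  have hD := measurable_deriv y₀
  set a : ℝ → ℝ := (Ioo 0 1).indicator fun x => (1 / 2) * (deriv y₀ x + z x) with ha
  set b : ℝ → ℝ := (Ioo 0 1).indicator fun x => (1 / 2) * (deriv y₀ x - z x) with hb
  have ham : Measurable a := Measurable.indicator (by fun_prop) measurableSet_Ioo
  have hbm : Measurable b := Measurable.indicator (by fun_prop) measurableSet_Ioo
  have haL : MemLp a 2 volume := (memLp_indicator_iff_restrict measurableSet_Ioo).2
    ((hd.pos_memH1.2.add hzL).const_mul _)
  have hbL : MemLp b 2 volume := (memLp_indicator_iff_restrict measurableSet_Ioo).2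
    ((hd.pos_memH1.2.sub hzL).const_mul _)
  refine ⟨fun x => a x + b (-x), by fun_prop,
    haL.add (hbL.comp_measurePreserving (Measure.measurePreserving_neg volume)), ?_, ?_⟩
  · intro x hx
    have h1 : x ∉ Ioo (0 : ℝ) 1 := fun h => hx ⟨by linarith [h.1], h.2⟩
    have h2 : -x ∉ Ioo (0 : ℝ) 1 := fun h => hx ⟨by linarith [h.2], by linarith [h.1]⟩
    simp only [ha, hb, indicator_of_notMem h1, indicator_of_notMem h2, add_zero]
  · have h1 := ae_spaceMeasure_iff.1 hzae
    have h2 := (Measure.measurePreserving_neg (volume : Measure ℝ)).quasiMeasurePreserving.ae h1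
    filter_upwards [h1, h2, Measure.ae_ne volume (0 : ℝ)] with x h1 h2 h0 hx
    rcases lt_or_gt_of_ne h0 with h | h
    · have m1 : x ∉ Ioo (0 : ℝ) 1 := fun h' => by linarith [h'.1]
      have m2 : -x ∈ Ioo (0 : ℝ) 1 := ⟨by linarith, by linarith [hx.1]⟩
      rw [ha, hb, indicator_of_notMem m1, indicator_of_mem m2, F, if_pos h, h2 m2, zero_add]
    · have m1 : x ∈ Ioo (0 : ℝ) 1 := ⟨h, hx.2⟩
      have m2 : -x ∉ Ioo (0 : ℝ) 1 := fun h' => by linarith [h'.1]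
      rw [ha, hb, indicator_of_notMem m2, indicator_of_mem m1, F, if_neg (by linarith), h1 m1,
        add_zero]

/-! ### Solving `G x + G (x - 2) = w x` by a locally finite alternating sum. -/

section Unfold

/-- Partial sums for the solution of `G x + G (x - 2) = w x`. -/
noncomputable def unfoldSum (w : ℝ → ℝ) (N : ℕ) (x : ℝ) : ℝ :=
  ∑ j ∈ Finset.range N, (-1) ^ j * w (x - 2 * j)

/-- The solution of `G x + G (x - 2) = w x` that vanishes on `(-∞, -1)`. -/
noncomputable def unfold (w : ℝ → ℝ) (x : ℝ) : ℝ := unfoldSum w (⌈|x|⌉₊ + 2) x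

variable {w : ℝ → ℝ}

/-- Terms with `x - 2 j < -1` vanish, so the sum stabilises as soon as `2 N > x + 1`, and one `N`
serves a whole bounded interval. -/
theorem unfoldSum_eq_of_le (hw : ∀ x < -1, w x = 0) {N M : ℕ} (hNM : N ≤ M) {x : ℝ}
    (hx : x + 1 < 2 * N) : unfoldSum w M x = unfoldSum w N x := by
  symm
  refine Finset.sum_subset (Finset.range_mono hNM) fun j _ hj => ?_
  have hj : (N : ℝ) ≤ j := by exact_mod_cast not_lt.1 (Finset.mem_range.not.1 hj)
  rw [hw _ (by linarith), mul_zero]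

theorem unfold_eq (hw : ∀ x < -1, w x = 0) {N : ℕ} {x : ℝ} (hx : x + 1 < 2 * N) :
    unfold w x = unfoldSum w N x := by
  have h0 : x + 1 < 2 * ((⌈|x|⌉₊ + 2 : ℕ) : ℝ) := by
    have h1 := Nat.le_ceil |x|
    have h2 := le_abs_self x
    have h3 := abs_nonneg x
    push_cast
    linarith
  rcases le_total N (⌈|x|⌉₊ + 2) with h | h
  · exact unfoldSum_eq_of_le hw h hx
  · exact (unfoldSum_eq_of_le hw h h0).symm

theorem unfold_add (hw : ∀ x < -1, w x = 0) (x : ℝ) : unfold w x + unfold w (x - 2) = w x := by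
  obtain ⟨N, hN⟩ := exists_nat_gt x
  have hN0 : (0 : ℝ) ≤ N := Nat.cast_nonneg N
  rw [unfold_eq hw (N := N + 2) (by push_cast; linarith),
    unfold_eq hw (N := N + 1) (by push_cast; linarith), unfoldSum, Finset.sum_range_succ',
    unfoldSum, add_right_comm, ← Finset.sum_add_distrib, Finset.sum_eq_zero, zero_add]
  · simp
  · intro j _
    rw [pow_succ]
    push_cast
    rw [show x - 2 * ((j : ℝ) + 1) = x - 2 - 2 * j by ring]
    ring

theorem unfold_of_lt_one (hw : ∀ x < -1, w x = 0) {x : ℝ} (hx : x < 1) : unfold w x = w x := by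
  rw [unfold_eq hw (N := 1) (by push_cast; linarith)]
  simp [unfoldSum]

theorem memLp_unfoldSum (hL : MemLp w 2 volume) (N : ℕ) : MemLp (unfoldSum w N) 2 volume :=
  memLp_finsetSum _ fun j _ =>
    (hL.comp_measurePreserving (measurePreserving_sub_right volume (2 * (j : ℝ)))).const_mul _

theorem locL2_unfold (hw : ∀ x < -1, w x = 0) (hm : Measurable w) (hL : MemLp w 2 volume) :
    LocL2 (unfold w) := by
  constructor
  · refine measurable_of_tendsto_metrizable (f := fun N => unfoldSum w N) (fun N => ?_)
      (tendsto_pi_nhds.2 fun x => ?_)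
    · unfold unfoldSum
      fun_prop
    · obtain ⟨N, hN⟩ := exists_nat_gt (x + 1)
      refine tendsto_const_nhds.congr' ?_
      filter_upwards [eventually_ge_atTop N] with M hM
      have hM' : (N : ℝ) ≤ M := by exact_mod_cast hM
      have : (0 : ℝ) ≤ N := Nat.cast_nonneg N
      exact unfold_eq hw (by linarith)
  · intro a b
    obtain ⟨N, hN⟩ := exists_nat_gt (b + 1)
    refine MemLp.ae_eq ?_ ((memLp_unfoldSum hL N).restrict _)
    filter_upwards [ae_restrict_mem measurableSet_Icc] with x hx
    have : (0 : ℝ) ≤ N := Nat.cast_nonneg N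
    exact (unfold_eq hw (by linarith [hx.2])).symm

end Unfold

/-- The equation `G x + G (x - 2) = w x` with `w x = Φ x + U (x - 1)` contains both requirements:
left of `1` it forces `G = Φ`, and at `x = t + 1` with `t ≥ 0` it says that `G` has control `u t`.
-/
theorem IsInitialData.exists_profile_of_control (hd : IsInitialData y₀ y₁) {u : ℝ → ℝ}
    (hm : Measurable u) (hu : MemLp u 2 (volume.restrict (timeInterval T))) :
    ∃ G, LocL2 G ∧ ExtendsData y₀ y₁ G ∧ ∀ t ∈ timeInterval T, u t = ctrlOf G t := by
  obtain ⟨Φ, hΦm, hΦL, hΦ0, hΦF⟩ := hd.exists_profile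
  set U := (timeInterval T).indicator u with hU
  have hUm : Measurable U := hm.indicator (measurableSet_timeInterval T)
  have hUL : MemLp U 2 volume := (memLp_indicator_iff_restrict (measurableSet_timeInterval T)).2 hu
  have hU0 : ∀ x < 0, U x = 0 := fun x hx => indicator_of_notMem (fun h => not_lt.2 h.1 hx) _
  set w : ℝ → ℝ := fun x => Φ x + U (x - 1) with hw
  have hwm : Measurable w := by fun_prop
  have hwL : MemLp w 2 volume :=
    hΦL.add (hUL.comp_measurePreserving (measurePreserving_sub_right volume 1))
  have hw0 : ∀ x < -1, w x = 0 := fun x hx => by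
    rw [hw]
    simp only
    rw [hΦ0 x fun h => by linarith [h.1], hU0 _ (by linarith), add_zero]
  refine ⟨unfold w, locL2_unfold hw0 hwm hwL, ?_, fun t ht => ?_⟩
  · filter_upwards [hΦF] with x hx hxm
    rw [unfold_of_lt_one hw0 hxm.2, hw]
    simp only
    rw [hU0 _ (by linarith [hxm.2]), add_zero, hx hxm]
  · have h := unfold_add hw0 (t + 1)
    rw [ctrlOf, show t - 1 = t + 1 - 2 by ring, h, hw]
    simp only
    rw [hΦ0 _ fun h => by linarith [h.2, ht.1], add_sub_cancel_right, hU, indicator_of_mem ht,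
      zero_add]

/-- The profile vanishes on the part of the line that is seen by the state at the final time. -/
def VanishesAtEnd (T : ℝ≥0∞) (G : ℝ → ℝ) : Prop :=
  ∀ᵐ x, x - 1 ∈ timeInterval T → x + 1 ∉ timeInterval T → G x = 0

/-- At time `T` both `G (T + x) + G (T - x)` and `G (T + x) - G (T - x)` vanish, hence so does each
wave. For an infinite horizon the condition is void. -/
theorem LocL2.vanishesAtEnd (hG : LocL2 G) (h : IsAtRestAtEnd T (posOf G) (velOf G)) :
    VanishesAtEnd T G := by
  by_cases hT : T = ∞
  · refine .of_forall fun x h1 h2 => absurd ?_ h2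
    rw [hT, timeInterval_top] at h1 ⊢
    have : 0 ≤ x - 1 := h1
    exact (by linarith : 0 ≤ x + 1)
  · obtain ⟨hp, hv⟩ := h hT
    set τ := T.toReal with hτ
    have key : ∀ᵐ x, x ∈ Ioo (0 : ℝ) 1 → G (τ + x) = 0 ∧ G (τ - x) = 0 := by
      refine ae_spaceMeasure_iff.1 ?_
      filter_upwards [hv, hG.deriv_posOf τ, ae_spaceMeasure_iff.2 (.of_forall fun x hx => hx)]
        with x h1 h2 hx
      have h3 : deriv (posOf G τ) x = 0 := by
        have : posOf G τ =ᶠ[𝓝 x] fun _ => 0 := by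
          filter_upwards [isOpen_Ioo.mem_nhds hx] with z hz
          exact hp z (Ioo_subset_Icc_self hz)
        rw [this.deriv_eq, deriv_const]
      rw [h3] at h2
      rw [velOf] at h1
      constructor <;> linarith
    have k1 := ae_comp_sub key τ
    have k2 := ae_comp_sub_left key τ
    rw [VanishesAtEnd, timeInterval_of_ne_top hT]
    filter_upwards [k1, k2, Measure.ae_ne volume (τ + 1), Measure.ae_ne volume τ]
      with x h1 h2 n1 n2 m1 m2
    have m2' : τ - 1 < x := by
      by_contra hc
      exact m2 ⟨by linarith [m1.1], by linarith⟩
    have m1' : x < τ + 1 := lt_of_le_of_ne (by linarith [m1.2]) n1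
    rcases lt_or_gt_of_ne n2 with h | h
    · have := (h2 ⟨by linarith, by linarith⟩).2
      rwa [sub_sub_cancel] at this
    · have := (h1 ⟨by linarith, by linarith⟩).1
      rwa [add_sub_cancel] at this

theorem LocL2.isAtRestAtEnd (hG : LocL2 G) (hT2 : 2 ≤ T) (h : VanishesAtEnd T G) :
    IsAtRestAtEnd T (posOf G) (velOf G) := by
  intro hT
  rw [VanishesAtEnd, timeInterval_of_ne_top hT] at h
  have hτ2 : 2 ≤ T.toReal := by
    have := ENNReal.toReal_mono hT hT2
    simpa using this
  set τ := T.toReal with hτ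
  have h0 : ∀ᵐ x, x ∈ Ioo (τ - 1) (τ + 1) → G x = 0 := by
    filter_upwards [h] with x hx hm
    exact hx ⟨by linarith [hm.1], by linarith [hm.2]⟩ fun h' => by linarith [hm.1, h'.2]
  constructor
  · intro x hx
    rw [hG.posOf_eq]
    refine intervalIntegral.integral_zero_ae ?_
    filter_upwards [h0, Measure.ae_ne volume (τ + 1)] with z hz n1 hm
    rw [uIoc_of_le (by linarith [hx.1])] at hm
    exact hz ⟨by linarith [hm.1, hx.2], lt_of_le_of_ne (by linarith [hm.2, hx.2]) n1⟩
  · refine ae_spaceMeasure_iff.2 ?_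
    filter_upwards [ae_comp_add h0 τ, ae_comp_sub_left h0 τ] with x h1 h2 hx
    rw [velOf, add_comm, h1 ⟨by linarith [hx.1], by linarith [hx.2]⟩,
      h2 ⟨by linarith [hx.2], by linarith [hx.1]⟩, sub_zero]

/-- Profiles of the states that satisfy the initial and the final condition. -/
structure IsProfile (T : ℝ≥0∞) (y₀ y₁ G : ℝ → ℝ) : Prop where
  locL2 : LocL2 G
  extendsData : ExtendsData y₀ y₁ G
  vanishesAtEnd : VanishesAtEnd T G

theorem ae_timeInterval {p : ℝ → Prop} :
    (∀ᵐ t ∂(volume.restrict (timeInterval T)), p t) ↔ ∀ᵐ t, t ∈ timeInterval T → p t :=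
  ae_restrict_iff' (measurableSet_timeInterval T)

/-- The profile is built from the control alone. Uniqueness of the state and of the trace then
transfers the final condition to it and identifies `g`. -/
theorem IsFeasible.exists_profile (hT : 2 ≤ T) (hd : IsInitialData y₀ y₁) {u : Control T}
    {y v : ℝ → ℝ → ℝ} {g : ℝ → ℝ} (h : IsFeasible T y₀ y₁ u y v g) :
    ∃ G, IsProfile T y₀ y₁ G ∧ (∀ᵐ t, t ∈ timeInterval T → u t = ctrlOf G t) ∧
      ∀ᵐ t, t ∈ timeInterval T → g t = 2 * G t := by
  obtain ⟨G, hG, hF, hu⟩ := hd.exists_profile_of_control (Lp.stronglyMeasurable u).measurable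
    (Lp.memLp u)
  have hu' : ∀ᵐ t, t ∈ timeInterval T → u t = ctrlOf G t := .of_forall hu
  have hs := hG.isSolution hd hF hu'
  refine ⟨G, ⟨hG, hF, hG.vanishesAtEnd fun hfin => ?_⟩, hu',
    hG.trace_unique hT hd hF hu' h.isSolution h.isTrace⟩
  have hmem : T.toReal ∈ timeInterval T := by
    rw [timeInterval_of_ne_top hfin]
    exact ⟨ENNReal.toReal_nonneg, le_rfl⟩
  obtain ⟨h1, h2⟩ := h.atRest hfin
  refine ⟨fun x hx => ?_, ?_⟩
  · rw [hs.pos_eq h.isSolution (fun _ _ => rfl) hmem x hx, h1 x hx]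
  · filter_upwards [hs.vel_eq hT h.isSolution (fun _ _ => rfl) hmem, h2] with x e1 e2
    rw [e1, e2]

theorem IsProfile.isFeasible (hT : 2 ≤ T) (hd : IsInitialData y₀ y₁) (hG : IsProfile T y₀ y₁ G)
    {u : Control T} (hu : ∀ᵐ t, t ∈ timeInterval T → u t = ctrlOf G t) :
    IsFeasible T y₀ y₁ u (posOf G) (velOf G) (fun t => 2 * G t) :=
  ⟨hG.locL2.isSolution hd hG.extendsData hu, hG.locL2.isTrace hG.extendsData hu,
    hG.locL2.isAtRestAtEnd hT hG.vanishesAtEnd⟩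

end

/-! ### The Euler-Lagrange equation characterises the optimal control. -/

section

variable {A B h : ℝ → ℝ} {y₀ y₁ : ℝ → ℝ} {T : ℝ≥0∞} {lam : ℝ}

/-- The cost density of a profile. -/
def costDensity (lam : ℝ) (G : ℝ → ℝ) (t : ℝ) : ℝ :=
  (1 - lam) * (2 * G t) ^ 2 + lam * ctrlOf G t ^ 2

/-- The polar form of the cost density. -/
def costPolar (lam : ℝ) (A h : ℝ → ℝ) (t : ℝ) : ℝ :=
  4 * (1 - lam) * (A t * h t) + lam * (ctrlOf A t * ctrlOf h t)

/-- The Euler-Lagrange expression of the cost. -/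
def eulerLagrange (lam : ℝ) (A : ℝ → ℝ) (x : ℝ) : ℝ :=
  4 * (1 - lam) * A x + lam * (A (x - 2) + 2 * A x + A (x + 2))

/-- The set on which profiles can be varied freely. -/
def freeZone (T : ℝ≥0∞) : Set ℝ := {x | 1 ≤ x ∧ x + 1 ∈ timeInterval T}

theorem costDensity_nonneg (hlam : lam ∈ Icc (0 : ℝ) 1) (G : ℝ → ℝ) (t : ℝ) :
    0 ≤ costDensity lam G t :=
  add_nonneg (mul_nonneg (by linarith [hlam.2]) (sq_nonneg _)) (mul_nonneg hlam.1 (sq_nonneg _))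

theorem measurableSet_freeZone (T : ℝ≥0∞) : MeasurableSet (freeZone T) :=
  (measurableSet_le measurable_const measurable_id).inter
    ((measurable_add_const 1) (measurableSet_timeInterval T))

theorem mem_timeInterval_of_le {s t : ℝ} (hs : 0 ≤ s) (hst : s ≤ t) (ht : t ∈ timeInterval T) :
    s ∈ timeInterval T := timeInterval_Icc_subset ht ⟨hs, hst⟩

theorem freeZone_subset (T : ℝ≥0∞) : freeZone T ⊆ timeInterval T := fun x hx =>
  mem_timeInterval_of_le (by linarith [hx.1]) (by linarith) hx.2

theorem two_mem_timeInterval (hT : 2 ≤ T) : (2 : ℝ) ∈ timeInterval T :=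
  ⟨by norm_num, by simpa using hT⟩

theorem memLp_shift (hA : MemLp A 2 volume) (c : ℝ) : MemLp (fun x => A (x + c)) 2 volume :=
  hA.comp_measurePreserving (measurePreserving_add_right volume c)

theorem memLp_ctrlOf (hA : MemLp A 2 volume) : MemLp (ctrlOf A) 2 volume := by
  have h := (memLp_shift hA 1).add (memLp_shift hA (-1))
  exact h

theorem integrable_costDensity (hA : MemLp A 2 volume) : Integrable (costDensity lam A) volume :=
  ((hA.const_mul 2).integrable_sq.const_mul _).add ((memLp_ctrlOf hA).integrable_sq.const_mul _)

theorem integrable_costPolar (hA : MemLp A 2 volume) (hh : MemLp h 2 volume) :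
    Integrable (costPolar lam A h) volume :=
  ((integrable_mul_of_memLp hA hh).const_mul _).add
    ((integrable_mul_of_memLp (memLp_ctrlOf hA) (memLp_ctrlOf hh)).const_mul _)

/-- Discrete integration by parts. -/
theorem integral_costPolar (hA : MemLp A 2 volume) (hh : MemLp h 2 volume) :
    ∫ t, costPolar lam A h t = ∫ t, eulerLagrange lam A t * h t := by
  have hc := memLp_ctrlOf hA
  have i1 := integrable_mul_of_memLp hc (memLp_shift hh 1)
  have i2 := integrable_mul_of_memLp hc (memLp_shift hh (-1))
  have j1 := integrable_mul_of_memLp (memLp_shift hc (-1)) hh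
  have j2 := integrable_mul_of_memLp (memLp_shift hc 1) hh
  have e1 : ∫ t, ctrlOf A t * h (t + 1) = ∫ t, ctrlOf A (t + -1) * h t := by
    rw [← integral_add_right_eq_self (fun t => ctrlOf A (t + -1) * h t) 1]
    simp
  have e2 : ∫ t, ctrlOf A t * h (t + -1) = ∫ t, ctrlOf A (t + 1) * h t := by
    rw [← integral_add_right_eq_self (fun t => ctrlOf A (t + 1) * h t) (-1)]
    simp
  have e3 : ∫ t, ctrlOf A t * ctrlOf h t
      = ∫ t, (ctrlOf A (t + -1) * h t + ctrlOf A (t + 1) * h t) := by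
    rw [integral_add j1 j2, ← e1, ← e2, ← integral_add i1 i2]
    simp only [ctrlOf, ← sub_eq_add_neg, mul_add]
  have i0 := integrable_mul_of_memLp hA hh
  have ic := integrable_mul_of_memLp hc (memLp_ctrlOf hh)
  have j12 : Integrable (fun t => lam * (ctrlOf A (t + -1) * h t + ctrlOf A (t + 1) * h t)) volume :=
    (j1.add j2).const_mul _
  unfold costPolar
  rw [integral_add (i0.const_mul _) (ic.const_mul _), integral_const_mul lam, e3,
    ← integral_const_mul lam, ← integral_add (i0.const_mul _) j12]
  congr 1
  funext t
  simp only [eulerLagrange, ctrlOf]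
  rw [show t + -1 + 1 = t by ring, show t + -1 - 1 = t - 2 by ring,
    show t + 1 + 1 = t + 2 by ring, add_sub_cancel_right]
  ring

/-- A variation supported in the free zone, and its shifts by `±1`, vanish outside the time
interval. The integral therefore extends to the whole line, where the shifts can be moved onto `A`.
-/
theorem setIntegral_costPolar_eq_zero (hA : MemLp A 2 volume) (hh : MemLp h 2 volume)
    (hh0 : ∀ x, x ∉ freeZone T → h x = 0)
    (hEL : ∀ᵐ x, x ∈ freeZone T → eulerLagrange lam A x = 0) :
    ∫ t in timeInterval T, costPolar lam A h t = 0 := by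
  rw [setIntegral_eq_integral_of_forall_compl_eq_zero, integral_costPolar hA hh]
  · apply integral_eq_zero_of_ae
    filter_upwards [hEL] with x hx
    by_cases hm : x ∈ freeZone T
    · simp [hx hm]
    · simp [hh0 x hm]
  · intro t ht
    have h0 : h t = 0 := hh0 t fun h' => ht (freeZone_subset T h')
    have h1 : h (t + 1) = 0 := hh0 _ fun h' =>
      ht (mem_timeInterval_of_le (by linarith [h'.1]) (by linarith) h'.2)
    have h2 : h (t - 1) = 0 := hh0 _ fun h' => ht (by
      have := h'.2
      rwa [sub_add_cancel] at this)
    simp [costPolar, ctrlOf, h0, h1, h2]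

/-- Profiles with the same initial and final conditions differ on the free zone only. -/
theorem IsProfile.ae_eq_add (hA : IsProfile T y₀ y₁ A) (hB : IsProfile T y₀ y₁ B) :
    ∀ᵐ x, x + 1 ∈ timeInterval T ∨ x - 1 ∈ timeInterval T →
      B x = A x + (freeZone T).indicator (fun x => B x - A x) x := by
  filter_upwards [hA.extendsData, hB.extendsData, hA.vanishesAtEnd, hB.vanishesAtEnd,
    Measure.ae_ne volume (-1 : ℝ)] with x a1 b1 a2 b2 hne hx
  by_cases hK : x ∈ freeZone T
  · rw [indicator_of_mem hK]; ring
  · rw [indicator_of_notMem hK, add_zero]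
    by_cases h1 : x + 1 ∈ timeInterval T
    · have hlt : x < 1 := by
        by_contra hc
        exact hK ⟨not_lt.1 hc, h1⟩
      have hgt : -1 < x := lt_of_le_of_ne (by linarith [h1.1]) (Ne.symm hne)
      rw [a1 ⟨hgt, hlt⟩, b1 ⟨hgt, hlt⟩]
    · have h2 := hx.resolve_left h1
      rw [a2 h2 h1, b2 h2 h1]

theorem ae_eq_add_on_timeInterval (hT : 2 ≤ T)
    (hAB : ∀ᵐ x, x + 1 ∈ timeInterval T ∨ x - 1 ∈ timeInterval T → B x = A x + h x) :
    ∀ᵐ t, t ∈ timeInterval T → B t = A t + h t ∧ ctrlOf B t = ctrlOf A t + ctrlOf h t := by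
  filter_upwards [hAB, ae_comp_add hAB 1, ae_comp_sub hAB 1] with t h0 h1 h2 ht
  rw [add_sub_cancel_right] at h1
  rw [sub_add_cancel] at h2
  refine ⟨h0 ?_, ?_⟩
  -- For `t < 1` one has `t + 1 ≤ 2`, which lies within the horizon; otherwise `t - 1` does.
  · rcases lt_or_ge t 1 with hlt | hge
    · exact Or.inl (mem_timeInterval_of_le (by linarith [ht.1]) (by linarith)
        (two_mem_timeInterval hT))
    · exact Or.inr (mem_timeInterval_of_le (by linarith) (by linarith) ht)
  · rw [ctrlOf, h1 (Or.inr ht), h2 (Or.inl ht)]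
    simp only [ctrlOf]
    ring

/-- Pythagoras: the cross term `2 * costPolar` integrates to zero by the Euler-Lagrange equation. -/
theorem lintegral_costDensity_add (hlam : lam ∈ Icc (0 : ℝ) 1) (hT : 2 ≤ T)
    (hA : MemLp A 2 volume) (hh : MemLp h 2 volume) (hh0 : ∀ x, x ∉ freeZone T → h x = 0)
    (hEL : ∀ᵐ x, x ∈ freeZone T → eulerLagrange lam A x = 0)
    (hAB : ∀ᵐ x, x + 1 ∈ timeInterval T ∨ x - 1 ∈ timeInterval T → B x = A x + h x) :
    ∫⁻ t in timeInterval T, ENNReal.ofReal (costDensity lam B t)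
      = (∫⁻ t in timeInterval T, ENNReal.ofReal (costDensity lam A t))
        + ∫⁻ t in timeInterval T, ENNReal.ofReal (costDensity lam h t) := by
  have iA : IntegrableOn (costDensity lam A) (timeInterval T) :=
    (integrable_costDensity hA).integrableOn
  have ih : IntegrableOn (costDensity lam h) (timeInterval T) :=
    (integrable_costDensity hh).integrableOn
  have ip : IntegrableOn (fun t => 2 * costPolar lam A h t) (timeInterval T) :=
    ((integrable_costPolar hA hh).const_mul 2).integrableOn
  have iAh : IntegrableOn (fun t => costDensity lam A t + costDensity lam h t) (timeInterval T) :=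
    iA.add ih
  have hsum : costDensity lam B =ᵐ[volume.restrict (timeInterval T)]
      fun t => costDensity lam A t + costDensity lam h t + 2 * costPolar lam A h t := by
    refine ae_timeInterval.2 ?_
    filter_upwards [ae_eq_add_on_timeInterval hT hAB] with t ht htm
    rw [costDensity, (ht htm).1, (ht htm).2]
    simp only [costDensity, costPolar]
    ring
  have iB : IntegrableOn (costDensity lam B) (timeInterval T) :=
    (iAh.add ip).congr hsum.symm
  have nn : ∀ G : ℝ → ℝ, 0 ≤ᵐ[volume.restrict (timeInterval T)] costDensity lam G :=
    fun G => .of_forall (costDensity_nonneg hlam G)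
  rw [← ofReal_integral_eq_lintegral_ofReal iB (nn B), ← ofReal_integral_eq_lintegral_ofReal iA (nn A),
    ← ofReal_integral_eq_lintegral_ofReal ih (nn h),
    ← ENNReal.ofReal_add (integral_nonneg_of_ae (nn A)) (integral_nonneg_of_ae (nn h)),
    integral_congr_ae hsum, integral_add iAh ip, integral_add iA ih, integral_const_mul,
    setIntegral_costPolar_eq_zero hA hh hh0 hEL, mul_zero, add_zero]

/-- For finite `T` local square-integrability suffices. For `T = ∞` it is the trace part of the
cost, with weight `1 - λ > 0`, that bounds the `L²` norm of `B`. -/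
theorem IsProfile.memLp_variation (hlam : lam ∈ Icc (0 : ℝ) 1) (hT : T = ∞ → lam < 1)
    (hB : IsProfile T y₀ y₁ B) (hA2 : MemLp A 2 volume)
    (hfin : ∫⁻ t in timeInterval T, ENNReal.ofReal (costDensity lam B t) ≠ ∞) :
    MemLp ((freeZone T).indicator (fun x => B x - A x)) 2 volume := by
  refine (memLp_indicator_iff_restrict (measurableSet_freeZone T)).2 (.sub ?_ (hA2.restrict _))
  by_cases hTtop : T = ∞
  · have hl := hT hTtop
    have hBm := hB.locL2.measurable
    refine MemLp.mono_measure (Measure.restrict_mono (freeZone_subset T) le_rfl) ?_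
    refine (memLp_two_iff_integrable_sq hBm.aestronglyMeasurable).2 ?_
    refine ⟨by fun_prop, ?_⟩
    have h1 : ∫⁻ t in timeInterval T, ENNReal.ofReal ((4 * (1 - lam)) * B t ^ 2) < ∞ := by
      refine lt_of_le_of_lt (lintegral_mono fun t => ENNReal.ofReal_le_ofReal ?_)
        (lt_top_iff_ne_top.2 hfin)
      have := mul_nonneg hlam.1 (sq_nonneg (ctrlOf B t))
      rw [costDensity]
      nlinarith
    have h2 : Integrable (fun t => (4 * (1 - lam)) * B t ^ 2)
        (volume.restrict (timeInterval T)) := by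
      refine ⟨by fun_prop, ?_⟩
      rw [hasFiniteIntegral_iff_ofReal]
      · exact h1
      · refine .of_forall fun t => mul_nonneg (by linarith) (sq_nonneg _)
    have h3 := h2.const_mul (4 * (1 - lam))⁻¹
    have hne : 4 * (1 - lam) ≠ 0 := by
      have : 0 < 1 - lam := by linarith
      positivity
    simp only [inv_mul_cancel_left₀ hne] at h3
    exact h3.2
  · refine MemLp.mono_measure (Measure.restrict_mono ?_ le_rfl) (hB.locL2.memLp 0 T.toReal)
    rw [← timeInterval_of_ne_top hTtop]
    exact freeZone_subset T

theorem cost_eq_lintegral_costDensity {u g G : ℝ → ℝ}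
    (hu : ∀ᵐ t, t ∈ timeInterval T → u t = ctrlOf G t)
    (hg : ∀ᵐ t, t ∈ timeInterval T → g t = 2 * G t) :
    cost T lam u g = ∫⁻ t in timeInterval T, ENNReal.ofReal (costDensity lam G t) := by
  apply lintegral_congr_ae
  refine ae_timeInterval.2 ?_
  filter_upwards [hu, hg] with t h1 h2 ht
  rw [h1 ht, h2 ht, costDensity]

/-- A square-integrable profile that solves the Euler-Lagrange equation generates the only
optimal control. -/
theorem IsProfile.isOptimal_iff (hlam : lam ∈ Icc (0 : ℝ) 1) (hT2 : 2 ≤ T) (hT : T = ∞ → lam < 1)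
    (hd : IsInitialData y₀ y₁) (hA : IsProfile T y₀ y₁ A) (hA2 : MemLp A 2 volume)
    (hEL : ∀ᵐ x, x ∈ freeZone T → eulerLagrange lam A x = 0) (u : Control T) :
    IsOptimal T lam y₀ y₁ u ↔ ∀ᵐ t, t ∈ timeInterval T → u t = ctrlOf A t := by
  have expand : ∀ B, IsProfile T y₀ y₁ B →
      ∫⁻ t in timeInterval T, ENNReal.ofReal (costDensity lam B t) ≠ ∞ →
      ∫⁻ t in timeInterval T, ENNReal.ofReal (costDensity lam B t)
        = (∫⁻ t in timeInterval T, ENNReal.ofReal (costDensity lam A t))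
          + ∫⁻ t in timeInterval T, ENNReal.ofReal (costDensity lam
              ((freeZone T).indicator (fun x => B x - A x)) t) := fun B hB hfin =>
    lintegral_costDensity_add hlam hT2 hA2 (hB.memLp_variation hlam hT hA2 hfin)
      (fun x hx => indicator_of_notMem hx _) hEL (hA.ae_eq_add hB)
  have hle : ∀ B, IsProfile T y₀ y₁ B →
      ∫⁻ t in timeInterval T, ENNReal.ofReal (costDensity lam A t)
        ≤ ∫⁻ t in timeInterval T, ENNReal.ofReal (costDensity lam B t) := by
    intro B hB
    by_cases hfin : ∫⁻ t in timeInterval T, ENNReal.ofReal (costDensity lam B t) = ∞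
    · rw [hfin]; exact le_top
    · rw [expand B hB hfin]; exact le_self_add
  have hAfin : ∫⁻ t in timeInterval T, ENNReal.ofReal (costDensity lam A t) ≠ ∞ :=
    ((integrable_costDensity hA2).integrableOn.lintegral_lt_top).ne
  constructor
  · rintro ⟨y, v, g, hf, hmin⟩
    obtain ⟨B, hB, huB, hgB⟩ := hf.exists_profile hT2 hd
    have hcA : MemLp (ctrlOf A) 2 (volume.restrict (timeInterval T)) := (memLp_ctrlOf hA2).restrict _
    have huA : ∀ᵐ t, t ∈ timeInterval T → hcA.toLp (ctrlOf A) t = ctrlOf A t :=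
      ae_timeInterval.1 hcA.coeFn_toLp
    have hc := hmin _ _ _ _ (hA.isFeasible hT2 hd huA)
    rw [cost_eq_lintegral_costDensity huB hgB,
      cost_eq_lintegral_costDensity huA (.of_forall fun t _ => rfl)] at hc
    have hBfin := ne_top_of_le_ne_top hAfin hc
    have hmem := hB.memLp_variation hlam hT hA2 hBfin
    have hAB := ae_eq_add_on_timeInterval hT2 (hA.ae_eq_add hB)
    have hexp := expand B hB hBfin
    set h := (freeZone T).indicator (fun x => B x - A x) with hdef
    -- The control of `A` is a competitor, so the cost of `B` is at most that of `A`; cancelling the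
    -- finite cost of `A` leaves nothing for the variation.
    have hzero : ∫⁻ t in timeInterval T, ENNReal.ofReal (costDensity lam h t) = 0 := by
      rw [hexp] at hc
      refine nonpos_iff_eq_zero.1 ((ENNReal.add_le_add_iff_left hAfin).1 ?_)
      rwa [add_zero]
    have hhm : Measurable h :=
      (hB.locL2.measurable.sub hA.locL2.measurable).indicator (measurableSet_freeZone T)
    have hq : ∀ᵐ t, t ∈ timeInterval T → costDensity lam h t = 0 := by
      rw [lintegral_eq_zero_iff (by unfold costDensity ctrlOf; fun_prop)] at hzero
      filter_upwards [ae_timeInterval.1 hzero] with t ht htm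
      exact le_antisymm (ENNReal.ofReal_eq_zero.1 (ht htm)) (costDensity_nonneg hlam h t)
    have hctrl : ∀ᵐ t, t ∈ timeInterval T → ctrlOf h t = 0 := by
      -- For `λ < 1` the variation itself vanishes. For `λ = 1` the cost sees only the control of
      -- the variation, which is all that is needed.
      rcases lt_or_eq_of_le hlam.2 with hl | hl
      · have hh0 : ∀ᵐ t, h t = 0 := by
          filter_upwards [hq] with t ht
          by_cases htm : t ∈ freeZone T
          · have h1 := ht (freeZone_subset T htm)
            rw [costDensity] at h1
            have h2 := mul_nonneg hlam.1 (sq_nonneg (ctrlOf h t))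
            have h3 : 0 ≤ (1 - lam) * (2 * h t) ^ 2 :=
              mul_nonneg (by linarith) (sq_nonneg _)
            have h4 : (1 - lam) * (2 * h t) ^ 2 = 0 := by linarith
            rcases mul_eq_zero.1 h4 with h5 | h5
            · linarith
            · have := pow_eq_zero_iff (two_ne_zero) |>.1 h5
              linarith
          · exact indicator_of_notMem htm _
        filter_upwards [ae_comp_add hh0 1, ae_comp_sub hh0 1] with t h1 h2 _
        rw [ctrlOf, h1, h2, add_zero]
      · filter_upwards [hq] with t ht htm
        have := ht htm
        rw [costDensity, hl] at this
        simpa using this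
    filter_upwards [huB, hAB, hctrl] with t h1 h2 h3 ht
    rw [h1 ht, (h2 ht).2, h3 ht, add_zero]
  · intro hu
    refine ⟨_, _, _, hA.isFeasible hT2 hd hu, ?_⟩
    intro u' y' v' g' hf'
    obtain ⟨B, hB, huB, hgB⟩ := hf'.exists_profile hT2 hd
    rw [cost_eq_lintegral_costDensity huB hgB,
      cost_eq_lintegral_costDensity hu (.of_forall fun t _ => rfl)]
    exact hle B hB

theorem IsProfile.existsUnique_isOptimal (hlam : lam ∈ Icc (0 : ℝ) 1) (hT2 : 2 ≤ T)
    (hT : T = ∞ → lam < 1) (hd : IsInitialData y₀ y₁) (hA : IsProfile T y₀ y₁ A)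
    (hA2 : MemLp A 2 volume)
    (hEL : ∀ᵐ x, x ∈ freeZone T → eulerLagrange lam A x = 0) :
    ∃! u : Control T, IsOptimal T lam y₀ y₁ u := by
  have hcA : MemLp (ctrlOf A) 2 (volume.restrict (timeInterval T)) := (memLp_ctrlOf hA2).restrict _
  refine ⟨hcA.toLp (ctrlOf A), (hA.isOptimal_iff hlam hT2 hT hd hA2 hEL _).2
    (ae_timeInterval.1 hcA.coeFn_toLp), fun u hu => ?_⟩
  apply Lp.ext
  exact Filter.EventuallyEq.trans
    (ae_timeInterval.2 ((hA.isOptimal_iff hlam hT2 hT hd hA2 hEL u).1 hu)) hcA.coeFn_toLp.symm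

end

/-! ### Scalar multipliers along the classes `r + 2ℕ`. -/

section

variable {y₀ y₁ : ℝ → ℝ} {T : ℝ≥0∞} {lam : ℝ} {m Φ : ℝ → ℝ}

/-- The index `k` of the period `[2k - 1, 2k + 1)` that contains `x ≥ -1`. -/
noncomputable def period (x : ℝ) : ℕ := ⌊(x + 1) / 2⌋₊

/-- The number of shifts by `2` that take `x` to the final zone of the horizon `τ`. -/
noncomputable def stepsLeft (τ x : ℝ) : ℕ := ⌈(τ - 1 - x) / 2⌉₊

theorem measurable_period : Measurable period :=
  Nat.measurable_floor.comp (by fun_prop)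

theorem measurable_stepsLeft (τ : ℝ) : Measurable (stepsLeft τ) :=
  Nat.measurable_ceil.comp (by fun_prop)

theorem period_eq {r : ℝ} (h0 : -1 ≤ r) (h1 : r < 1) (k : ℕ) : period (r + 2 * k) = k := by
  have hk : (0 : ℝ) ≤ k := Nat.cast_nonneg k
  rw [period, Nat.floor_eq_iff (by linarith)]
  constructor <;> linarith

theorem period_add_two {x : ℝ} (hx : -1 ≤ x) : period (x + 2) = period x + 1 := by
  rw [period, show (x + 2 + 1) / 2 = (x + 1) / 2 + 1 by ring,
    Nat.floor_add_one (by linarith)]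
  rfl

/-- The bound on `x` keeps `(τ - 1 - x) / 2` above `-1`, so cutting the ceiling off at `0` loses
nothing. -/
theorem stepsLeft_sub_two {τ x : ℝ} (hx : x < τ + 1) :
    stepsLeft τ (x - 2) = stepsLeft τ x + 1 := by
  rw [stepsLeft, show (τ - 1 - (x - 2)) / 2 = (τ - 1 - x) / 2 + 1 by ring]
  apply le_antisymm
  · refine Nat.ceil_le.2 ?_
    have := Nat.le_ceil ((τ - 1 - x) / 2)
    rw [stepsLeft]
    push_cast
    linarith
  · rw [Nat.add_one_le_iff, Nat.lt_ceil]
    rcases Nat.eq_zero_or_pos (stepsLeft τ x) with h | h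
    · rw [h, Nat.cast_zero]; linarith
    · have := (Nat.lt_ceil (n := stepsLeft τ x - 1) (a := (τ - 1 - x) / 2)).1
        (Nat.sub_lt h one_pos)
      rw [Nat.cast_pred h] at this
      linarith

/-- The profile with multiplier `m` built on the periodic extension of `Φ`. -/
noncomputable def spread (m Φ : ℝ → ℝ) (x : ℝ) : ℝ := m x * Φ (x - 2 * period x)

theorem spread_eq {r : ℝ} (h0 : -1 ≤ r) (h1 : r < 1) (k : ℕ) :
    spread m Φ (r + 2 * k) = m (r + 2 * k) * Φ r := by
  rw [spread, period_eq h0 h1, add_sub_cancel_right]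

/-- Scalar multipliers whose profiles are optimal. -/
structure IsMultiplier (lam : ℝ) (T : ℝ≥0∞) (m : ℝ → ℝ) : Prop where
  measurable : Measurable m
  init : ∀ x ∈ Ioo (-1 : ℝ) 1, m x = 1
  vanish : ∀ x, x - 1 ∈ timeInterval T → x + 1 ∉ timeInterval T → m x = 0
  euler : ∀ᵐ x, x ∈ freeZone T → eulerLagrange lam m x = 0
  decay : ∃ C r : ℝ, 0 ≤ r ∧ r < 1 ∧ ∀ x, |m x| ≤ C * r ^ period x

/-- The squared profile is dominated by the sum over all periods of translates of `Φ²` with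
geometric weights. Translates have equal norms, so a geometric series bounds the integral. -/
theorem memLp_spread (hmm : Measurable m) {C r : ℝ} (hr0 : 0 ≤ r) (hr1 : r < 1) (hmr : ∀ x, |m x| ≤ C * r ^ period x)
    (hΦm : Measurable Φ) (hΦ : MemLp Φ 2 volume) : MemLp (spread m Φ) 2 volume := by
  have hpm : Measurable fun x => (period x : ℝ) := measurable_from_nat.comp measurable_period
  -- The point `-1` has period `0`, so the bound there reads `|m (-1)| ≤ C`.
  have hC : 0 ≤ C := by
    have h := (abs_nonneg _).trans (hmr (-1))
    simpa [period] using h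
  have hsm : Measurable (spread m Φ) := by
    unfold spread
    fun_prop
  refine ⟨hsm.aestronglyMeasurable, ?_⟩
  have hsq : eLpNorm (spread m Φ) 2 volume ^ 2 < ∞ := by
    rw [eLpNorm_two_sq]
    calc ∫⁻ x, ‖spread m Φ x‖ₑ ^ 2
        ≤ ∫⁻ x, ∑' k : ℕ, ENNReal.ofReal C ^ 2 * (ENNReal.ofReal r ^ 2) ^ k
            * ‖Φ (x - 2 * k)‖ₑ ^ 2 := by
          refine lintegral_mono fun x => ?_
          refine le_trans ?_ (ENNReal.le_tsum (period x))
          rw [spread, enorm_mul, mul_pow]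
          gcongr
          rw [← pow_mul, mul_comm 2, pow_mul, ← mul_pow]
          gcongr
          rw [← ENNReal.ofReal_pow hr0, ← ENNReal.ofReal_mul hC, ← ofReal_norm]
          exact ENNReal.ofReal_le_ofReal (hmr x)
      _ = ∑' k : ℕ, ENNReal.ofReal C ^ 2 * (ENNReal.ofReal r ^ 2) ^ k * eLpNorm Φ 2 volume ^ 2 := by
          rw [lintegral_tsum (fun k => by fun_prop)]
          congr 1
          funext k
          rw [lintegral_const_mul _ (by fun_prop), eLpNorm_two_sq,
            lintegral_sub_right_eq_self (fun x => ‖Φ x‖ₑ ^ 2)]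
      _ < ∞ := by
          rw [ENNReal.tsum_mul_right, ENNReal.tsum_mul_left, ENNReal.tsum_geometric]
          have hq : ENNReal.ofReal r ^ 2 < 1 := by
            rw [← ENNReal.ofReal_pow hr0, ENNReal.ofReal_lt_one]
            exact pow_lt_one₀ hr0 hr1 two_ne_zero
          refine ENNReal.mul_lt_top (ENNReal.mul_lt_top (by finiteness) ?_)
            (ENNReal.pow_lt_top hΦ.2)
          rw [ENNReal.inv_lt_top]
          exact tsub_pos_of_lt hq
  by_contra hc
  rw [not_lt, top_le_iff] at hc
  simp [hc] at hsq

theorem IsMultiplier.memLp_spread (hm : IsMultiplier lam T m) (hΦm : Measurable Φ)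
    (hΦ : MemLp Φ 2 volume) : MemLp (spread m Φ) 2 volume := by
  obtain ⟨C, r, h0, h1, h⟩ := hm.decay
  exact WaveOCP.memLp_spread hm.measurable h0 h1 h hΦm hΦ

theorem IsMultiplier.isProfile (hm : IsMultiplier lam T m) (hΦm : Measurable Φ)
    (hΦ : MemLp Φ 2 volume) (hF : ExtendsData y₀ y₁ Φ) : IsProfile T y₀ y₁ (spread m Φ) := by
  refine ⟨LocL2.of_memLp ?_ (hm.memLp_spread hΦm hΦ), ?_, ?_⟩
  · have hpm : Measurable fun x => (period x : ℝ) := measurable_from_nat.comp measurable_period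
    have := hm.measurable
    unfold spread
    fun_prop
  · filter_upwards [hF] with x hx hxm
    have := spread_eq (m := m) (Φ := Φ) hxm.1.le hxm.2 0
    simp only [Nat.cast_zero, mul_zero, add_zero] at this
    rw [this, hm.init x hxm, one_mul, hx hxm]
  · exact .of_forall fun x h1 h2 => by rw [spread, hm.vanish x h1 h2, zero_mul]

/-- Shifts by `±2` keep the residue `x - 2 * period x`, so `Φ` is a common factor and the scalar
recurrence remains. -/
theorem IsMultiplier.eulerLagrange_spread (hm : IsMultiplier lam T m) (Φ : ℝ → ℝ) :
    ∀ᵐ x, x ∈ freeZone T → eulerLagrange lam (spread m Φ) x = 0 := by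
  filter_upwards [hm.euler] with x hxe hx
  have h1 := period_add_two (x := x) (by linarith [hx.1])
  have h2 := period_add_two (x := x - 2) (by linarith [hx.1])
  rw [sub_add_cancel] at h2
  have e := hxe hx
  rw [eulerLagrange] at e ⊢
  have a1 : x + 2 - 2 * (period (x + 2) : ℝ) = x - 2 * period x := by rw [h1]; push_cast; ring
  have a2 : x - 2 - 2 * (period (x - 2) : ℝ) = x - 2 * period x := by rw [h2]; push_cast; ring
  rw [spread, spread, spread, a1, a2]
  linear_combination Φ (x - 2 * period x) * e

/-- The optimal control is generated by the multiplier. -/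
theorem IsMultiplier.optimal (hm : IsMultiplier lam T m) (hlam : lam ∈ Icc (0 : ℝ) 1)
    (hT2 : 2 ≤ T) (hT : T = ∞ → lam < 1) (hd : IsInitialData y₀ y₁) (hΦm : Measurable Φ)
    (hΦ : MemLp Φ 2 volume) (hF : ExtendsData y₀ y₁ Φ) (u : Control T) :
    IsOptimal T lam y₀ y₁ u ↔ ∀ᵐ t, t ∈ timeInterval T → u t = ctrlOf (spread m Φ) t :=
  (hm.isProfile hΦm hΦ hF).isOptimal_iff hlam hT2 hT hd (hm.memLp_spread hΦm hΦ)
    (hm.eulerLagrange_spread Φ) u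

theorem IsMultiplier.existsUnique (hm : IsMultiplier lam T m) (hlam : lam ∈ Icc (0 : ℝ) 1)
    (hT2 : 2 ≤ T) (hT : T = ∞ → lam < 1) (hd : IsInitialData y₀ y₁) :
    ∃! u : Control T, IsOptimal T lam y₀ y₁ u := by
  obtain ⟨Φ, hΦm, hΦ, -, hF⟩ := hd.exists_profile
  exact (hm.isProfile hΦm hΦ hF).existsUnique_isOptimal hlam hT2 hT hd (hm.memLp_spread hΦm hΦ)
    (hm.eulerLagrange_spread Φ)

theorem IsMultiplier.optimal_formula (hm : IsMultiplier lam T m) (hlam : lam ∈ Icc (0 : ℝ) 1)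
    (hT2 : 2 ≤ T) (hT : T = ∞ → lam < 1) (hd : IsInitialData y₀ y₁) {u : Control T}
    (hu : IsOptimal T lam y₀ y₁ u) :
    ∀ᵐ t ∂(volume.restrict (Ioo (0 : ℝ) 2)), ∀ k : ℕ, t + 2 * (k : ℝ) ∈ timeInterval T →
      u (t + 2 * (k : ℝ))
        = (m (t - 1 + 2 * (k + 1 : ℕ)) + m (t - 1 + 2 * (k : ℕ))) * F y₀ y₁ (t - 1) := by
  obtain ⟨Φ, hΦm, hΦ, -, hF⟩ := hd.exists_profile
  have h := (hm.optimal hlam hT2 hT hd hΦm hΦ hF u).1 hu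
  -- Countably many shifts, so one null set of `t` serves every `k`.
  have h' : ∀ᵐ t : ℝ, ∀ k : ℕ, t + 2 * (k : ℝ) ∈ timeInterval T →
      u (t + 2 * (k : ℝ)) = ctrlOf (spread m Φ) (t + 2 * (k : ℝ)) :=
    ae_all_iff.2 fun k => ae_comp_add h (2 * (k : ℝ))
  rw [ae_restrict_iff' measurableSet_Ioo]
  filter_upwards [h', ae_comp_sub hF 1] with t h1 h2 ht k hk
  have m0 : -1 ≤ t - 1 := by linarith [ht.1]
  have m1 : t - 1 < 1 := by linarith [ht.2]
  rw [h1 k hk, ctrlOf, show t + 2 * (k : ℝ) + 1 = t - 1 + 2 * (k + 1 : ℕ) by push_cast; ring,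
    show t + 2 * (k : ℝ) - 1 = t - 1 + 2 * (k : ℕ) by ring, spread_eq m0 m1, spread_eq m0 m1,
    h2 ⟨by linarith [ht.1], m1⟩, add_mul]

/-! ### The characteristic root `z_λ`. -/

section ZRoot

/-- With `s = √(1 - λ)` the numerator is `-(1 - s)(1 + s)` and the denominator is `(1 + s)²`. -/
theorem zRoot_eq (h : lam < 1) : zRoot lam = -(1 - √(1 - lam)) / (1 + √(1 - lam)) := by
  have hs : √(1 - lam) ^ 2 = 1 - lam := Real.sq_sqrt (by linarith)
  have hs0 : 0 ≤ √(1 - lam) := Real.sqrt_nonneg _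
  rw [zRoot]
  generalize √(1 - lam) = s at hs hs0
  have hl : lam = 1 - s ^ 2 := by linarith
  subst hl
  rw [div_eq_div_iff (by nlinarith) (by linarith)]
  ring

theorem zRoot_mem (h0 : 0 ≤ lam) (h1 : lam < 1) : zRoot lam ∈ Ioc (-1 : ℝ) 0 := by
  have hs0 : 0 < √(1 - lam) := Real.sqrt_pos.2 (by linarith)
  have hs1 : √(1 - lam) ≤ 1 := Real.sqrt_le_one.2 (by linarith)
  rw [zRoot_eq h1]
  constructor
  · rw [lt_div_iff₀ (by linarith)]; linarith
  · exact div_nonpos_of_nonpos_of_nonneg (by linarith) (by linarith)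

theorem zRoot_neg (h0 : 0 < lam) (h1 : lam < 1) : zRoot lam < 0 := by
  have hs0 : 0 ≤ √(1 - lam) := Real.sqrt_nonneg _
  exact div_neg_of_neg_of_pos (by linarith) (by linarith)

theorem zRoot_zero : zRoot 0 = 0 := by simp [zRoot]

theorem abs_zRoot_lt_one (h0 : 0 ≤ lam) (h1 : lam < 1) : |zRoot lam| < 1 := by
  have := zRoot_mem h0 h1
  rw [abs_lt]
  exact ⟨this.1, lt_of_le_of_lt this.2 one_pos⟩

/-- This is the characteristic equation of the Euler-Lagrange recurrence; its coefficients are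
symmetric, so for `λ > 0` the other root is `1 / z_λ`. -/
theorem zRoot_quadratic (h1 : lam < 1) :
    lam * zRoot lam ^ 2 + (4 - 2 * lam) * zRoot lam + lam = 0 := by
  have hs : √(1 - lam) ^ 2 = 1 - lam := Real.sq_sqrt (by linarith)
  have hs0 : 0 ≤ √(1 - lam) := Real.sqrt_nonneg _
  rw [zRoot_eq h1]
  generalize √(1 - lam) = s at hs hs0
  have hl : lam = 1 - s ^ 2 := by linarith
  subst hl
  have : 1 + s ≠ 0 := by positivity
  field_simp
  ring

end ZRoot

/-- The multiplier for the infinite horizon. -/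
noncomputable def topMultiplier (z x : ℝ) : ℝ := if x < -1 then 0 else z ^ period x

theorem topMultiplier_eq {z r : ℝ} (h0 : -1 ≤ r) (h1 : r < 1) (k : ℕ) :
    topMultiplier z (r + 2 * k) = z ^ k := by
  have : (0 : ℝ) ≤ k := Nat.cast_nonneg k
  rw [topMultiplier, if_neg (by linarith), period_eq h0 h1]

theorem period_eq_zero {x : ℝ} (h0 : -1 < x) (h1 : x < 1) : period x = 0 := by
  have := period_eq h0.le h1 0
  simpa using this

/-- The powers of the root inside the unit disc solve the recurrence and decay, which replaces a
final condition. -/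
theorem isMultiplier_top (h0 : 0 ≤ lam) (h1 : lam < 1) :
    IsMultiplier lam ∞ (topMultiplier (zRoot lam)) where
  measurable := Measurable.ite measurableSet_Iio measurable_const
    ((measurable_from_nat (f := fun k => zRoot lam ^ k)).comp measurable_period)
  init x hx := by
    rw [topMultiplier, if_neg (not_lt.2 hx.1.le), period_eq_zero hx.1 hx.2, pow_zero]
  vanish x h h' := by
    rw [timeInterval_top] at h h'
    have : 0 ≤ x - 1 := h
    exact absurd (by linarith : 0 ≤ x + 1) h'
  euler := .of_forall fun x hx => by
    have hx1 := hx.1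
    have e1 := period_add_two (x := x) (by linarith)
    have e2 := period_add_two (x := x - 2) (by linarith)
    rw [sub_add_cancel] at e2
    rw [eulerLagrange, topMultiplier, topMultiplier, topMultiplier, if_neg (by linarith),
      if_neg (by linarith), if_neg (by linarith), e1, e2]
    linear_combination zRoot lam ^ period (x - 2) * zRoot_quadratic h1
  decay := by
    refine ⟨1, |zRoot lam|, abs_nonneg _, abs_zRoot_lt_one h0 h1, fun x => ?_⟩
    rw [one_mul, topMultiplier]
    split_ifs
    · rw [abs_zero]; positivity
    · rw [abs_pow]

/-- The multiplier for a finite horizon with coefficients `c`. -/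
noncomputable def finMultiplier (c : ℕ → ℕ → ℝ) (τ x : ℝ) : ℝ :=
  if x < -1 then 0 else c (period x) (stepsLeft τ x)

/-- Along a class, `k` counts the steps from the initial zone and `j` those left to the final zone.
A step raises `k` and lowers `j`, so `k + j` is constant on the class. The hypotheses are thus a
boundary value problem of length `k + j`, and the length may differ between classes, which covers
every finite `T ≥ 2`. -/
theorem isMultiplier_fin {c : ℕ → ℕ → ℝ} (hT2 : 2 ≤ T) (hT : T ≠ ∞) (hc0 : ∀ k, c k 0 = 0)
    (hc1 : ∀ j, c 0 (j + 1) = 1) (hcb : ∀ k j, |c k j| ≤ 1)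
    (hcE : ∀ k j, 4 * (1 - lam) * c (k + 1) (j + 1)
      + lam * (c k (j + 2) + 2 * c (k + 1) (j + 1) + c (k + 2) j) = 0) :
    IsMultiplier lam T (finMultiplier c T.toReal) := by
  have hS := timeInterval_of_ne_top hT
  have hτ2 : 2 ≤ T.toReal := by
    have := ENNReal.toReal_mono hT hT2
    simpa using this
  set τ := T.toReal with hτ
  refine ⟨?_, fun x hx => ?_, fun x h h' => ?_, ?_, ?_⟩
  · refine Measurable.ite measurableSet_Iio measurable_const ?_
    exact (measurable_of_countable (fun p : ℕ × ℕ => c p.1 p.2)).comp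
      (measurable_period.prodMk (measurable_stepsLeft τ))
  · rw [finMultiplier, if_neg (not_lt.2 hx.1.le), period_eq_zero hx.1 hx.2]
    have hpos : 0 < stepsLeft τ x := Nat.ceil_pos.2 (by linarith [hx.2])
    obtain ⟨j, hj⟩ := Nat.exists_eq_succ_of_ne_zero hpos.ne'
    rw [hj, hc1]
  · rw [hS] at h h'
    have h1 : τ < x + 1 := by
      by_contra hcon
      exact h' ⟨by linarith [h.1], not_lt.1 hcon⟩
    rw [finMultiplier, if_neg (by linarith [h.1]), stepsLeft, Nat.ceil_eq_zero.2 (by linarith), hc0]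
  -- At `x = τ - 1`, the end of the free zone, no step is left and the recurrence may fail; this
  -- single point is discarded.
  · filter_upwards [Measure.ae_ne volume (τ - 1)] with x hne hx
    have hx1 := hx.1
    have hx2 := hx.2
    rw [hS] at hx2
    have hx3 : x < τ - 1 := lt_of_le_of_ne (by linarith [hx2.2]) hne
    have e1 := period_add_two (x := x) (by linarith)
    have e2 := period_add_two (x := x - 2) (by linarith)
    rw [sub_add_cancel] at e2
    have s1 := stepsLeft_sub_two (τ := τ) (x := x) (by linarith)
    have s2 := stepsLeft_sub_two (τ := τ) (x := x + 2) (by linarith)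
    rw [add_sub_cancel_right] at s2
    rw [eulerLagrange, finMultiplier, finMultiplier, finMultiplier, if_neg (by linarith),
      if_neg (by linarith), if_neg (by linarith), e1, s1, e2, s2]
    exact hcE _ _
  -- Any ratio in `(0, 1)` would do: the multiplier vanishes from `τ - 1` on, so only periods up to
  -- `⌈τ⌉` count, and the constant absorbs them.
  · refine ⟨2 ^ ⌈τ⌉₊, 1 / 2, by norm_num, by norm_num, fun x => ?_⟩
    rw [finMultiplier]
    split_ifs with hx
    · rw [abs_zero]; positivity
    · rcases lt_or_ge x (τ - 1) with h | h
      · refine (hcb _ _).trans ?_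
        have hk : period x ≤ ⌈τ⌉₊ := by
          have h1 : (period x : ℝ) ≤ (x + 1) / 2 := Nat.floor_le (by linarith)
          have h2 := Nat.le_ceil τ
          have : (period x : ℝ) ≤ ⌈τ⌉₊ := by linarith
          exact_mod_cast this
        rw [one_div, inv_pow, ← div_eq_mul_inv, one_le_div (by positivity)]
        exact pow_le_pow_right₀ (by norm_num) hk
      · rw [stepsLeft, Nat.ceil_eq_zero.2 (by linarith), hc0, abs_zero]
        positivity

end

/-! ### Explicit coefficients, control formulas and energy decay. -/

section

variable {y₀ y₁ : ℝ → ℝ} {T : ℝ≥0∞} {lam : ℝ} {m Φ : ℝ → ℝ}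

/-- Optimal coefficients for a finite horizon and `lam < 1`. -/
noncomputable def geomCoeff (z : ℝ) (k j : ℕ) : ℝ := z ^ k * (1 - z ^ (2 * j)) / (1 - z ^ (2 * (k + j)))

/-- Optimal coefficients for a finite horizon and `lam = 1`. -/
noncomputable def linearCoeff (k j : ℕ) : ℝ := (-1) ^ k * (j / (k + j))

theorem pow_two_mul_lt_one {z : ℝ} (hz : |z| < 1) {n : ℕ} (hn : n ≠ 0) : z ^ (2 * n) < 1 := by
  rw [← (even_two_mul n).pow_abs]
  exact pow_lt_one₀ (abs_nonneg z) hz (by omega)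

/-- For `z ≠ 0` and a fixed sum `k + j`, the coefficient is the combination of `z ^ k` and `z ^
(-k)` equal to `1` at `k = 0` and to `0` at `j = 0`. Written without negative powers it also covers
`z = 0`. -/
theorem isMultiplier_geom (hT2 : 2 ≤ T) (hT : T ≠ ∞) (h0 : 0 ≤ lam) (h1 : lam < 1) :
    IsMultiplier lam T (finMultiplier (geomCoeff (zRoot lam)) T.toReal) := by
  have hz := abs_zRoot_lt_one h0 h1
  have hquad := zRoot_quadratic h1
  set z := zRoot lam
  refine isMultiplier_fin hT2 hT (fun k => ?_) (fun j => ?_) (fun k j => ?_) (fun k j => ?_)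
  · simp [geomCoeff]
  · have := pow_two_mul_lt_one hz (Nat.succ_ne_zero j)
    rw [geomCoeff, pow_zero, one_mul, zero_add, div_self (sub_pos.2 this).ne']
  · have hp : ∀ n : ℕ, 0 ≤ z ^ (2 * n) := fun n => (even_two_mul n).pow_nonneg z
    have hle : z ^ (2 * (k + j)) ≤ z ^ (2 * j) := by
      rw [← (even_two_mul _).pow_abs, ← (even_two_mul j).pow_abs]
      exact pow_le_pow_of_le_one (abs_nonneg z) hz.le (by omega)
    have hle1 : z ^ (2 * j) ≤ 1 := by
      rw [← (even_two_mul j).pow_abs]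
      exact pow_le_one₀ (abs_nonneg z) hz.le
    rw [geomCoeff, mul_div_assoc, abs_mul, abs_pow]
    refine mul_le_one₀ (pow_le_one₀ (abs_nonneg z) hz.le) (abs_nonneg _) ?_
    rw [abs_of_nonneg (div_nonneg (by linarith) (by linarith))]
    exact div_le_one_of_le₀ (by linarith) (by linarith)
  · have e1 : k + (j + 2) = k + j + 2 := by ring
    have e2 : k + 1 + (j + 1) = k + j + 2 := by ring
    have e3 : k + 2 + j = k + j + 2 := by ring
    simp only [geomCoeff, e1, e2, e3]
    have hd : 1 - z ^ (2 * (k + j + 2)) ≠ 0 := by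
      have := pow_two_mul_lt_one hz (Nat.succ_ne_zero (k + j + 1))
      exact (sub_pos.2 this).ne'
    field_simp
    -- Cleared of denominators, the growing and the decaying part of the recurrence each carry the
    -- characteristic polynomial as a factor.
    have : (lam * z ^ 2 + (4 - 2 * lam) * z + lam) * (z ^ k * (1 - z ^ (2 * j + 2))) = 0 := by
      rw [hquad, zero_mul]
    linear_combination this

/-- At `λ = 1` the characteristic polynomial is `(z + 1)²`; the double root contributes `(-1) ^ k`
times affine functions of `k`. -/
theorem isMultiplier_linear (hT2 : 2 ≤ T) (hT : T ≠ ∞) :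
    IsMultiplier 1 T (finMultiplier linearCoeff T.toReal) := by
  refine isMultiplier_fin hT2 hT (fun k => ?_) (fun j => ?_) (fun k j => ?_) (fun k j => ?_)
  · simp [linearCoeff]
  · have : ((j + 1 : ℕ) : ℝ) ≠ 0 := by positivity
    simp only [linearCoeff, pow_zero, Nat.cast_zero, zero_add, div_self this, one_mul]
  · have hk : (0 : ℝ) ≤ k := Nat.cast_nonneg k
    have hj : (0 : ℝ) ≤ j := Nat.cast_nonneg j
    rw [linearCoeff, abs_mul, abs_pow, abs_neg, abs_one, one_pow, one_mul,
      abs_of_nonneg (by positivity)]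
    exact div_le_one_of_le₀ (by linarith) (by linarith)
  · simp only [linearCoeff]
    push_cast
    have e1 : (k : ℝ) + (j + 2) = k + j + 2 := by ring
    have e2 : (k : ℝ) + 1 + (j + 1) = k + j + 2 := by ring
    have e3 : (k : ℝ) + 2 + j = k + j + 2 := by ring
    rw [e1, e2, e3]
    ring

/-- For the horizon `2 n` the number of steps left is the ceiling of `n - k - (1 + r) / 2`, so all
classes have the same length `n`. -/
theorem finMultiplier_eq (c : ℕ → ℕ → ℝ) {n k : ℕ} (hkn : k ≤ n) {r : ℝ} (hr0 : -1 < r)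
    (hr1 : r < 1) : finMultiplier c (2 * n) (r + 2 * k) = c k (n - k) := by
  have hk : (0 : ℝ) ≤ k := Nat.cast_nonneg k
  rw [finMultiplier, if_neg (by linarith), period_eq hr0.le hr1]
  congr 1
  rw [stepsLeft]
  have hcast : ((n - k : ℕ) : ℝ) = n - k := Nat.cast_sub hkn
  apply le_antisymm
  · refine Nat.ceil_le.2 ?_
    rw [hcast]; linarith
  · by_contra hc
    rw [not_le, ← Nat.add_one_le_iff] at hc
    have h1 := Nat.le_ceil ((2 * (n : ℝ) - 1 - (r + 2 * k)) / 2)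
    have h2 : ((⌈(2 * (n : ℝ) - 1 - (r + 2 * k)) / 2⌉₊ : ℝ)) + 1 ≤ (n - k : ℕ) := by
      exact_mod_cast hc
    rw [hcast] at h2
    linarith

theorem F_sub_one_of_lt {t : ℝ} (ht : t < 1) :
    F y₀ y₁ (t - 1) = (1 / 2) * (deriv y₀ (1 - t) - y₁ (1 - t)) := by
  rw [F, if_pos (by linarith), neg_sub]

theorem F_sub_one_of_le {t : ℝ} (ht : 1 ≤ t) :
    F y₀ y₁ (t - 1) = (1 / 2) * (deriv y₀ (t - 1) + y₁ (t - 1)) := by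
  rw [F, if_neg (by linarith)]

/-- The optimal control for an even horizon. -/
theorem even_horizon_formula {c : ℕ → ℕ → ℝ} {n : ℕ} (hTn : T.toReal = 2 * (n : ℝ)) (hT2 : 2 ≤ T)
    (hT : T ≠ ∞) (hm : IsMultiplier lam T (finMultiplier c T.toReal)) (hlam : lam ∈ Icc (0 : ℝ) 1)
    (hd : IsInitialData y₀ y₁) {u : Control T} (hu : IsOptimal T lam y₀ y₁ u) :
    ∀ᵐ t ∂(volume.restrict (Ioo (0 : ℝ) 2)), ∀ k : ℕ, t + 2 * (k : ℝ) ≤ 2 * (n : ℝ) →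
      k < n ∧ u (t + 2 * (k : ℝ)) = (c (k + 1) (n - (k + 1)) + c k (n - k)) * F y₀ y₁ (t - 1) := by
  filter_upwards [hm.optimal_formula hlam hT2 (fun h => absurd h hT) hd hu,
    ae_restrict_mem measurableSet_Ioo] with t h ht k hk
  have hkn : k < n := by
    have : (k : ℝ) < n := by linarith [ht.1]
    exact_mod_cast this
  refine ⟨hkn, ?_⟩
  have hk0 : (0 : ℝ) ≤ k := Nat.cast_nonneg k
  have hmem : t + 2 * (k : ℝ) ∈ timeInterval T := by
    rw [timeInterval_of_ne_top hT, hTn]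
    exact ⟨by linarith [ht.1], hk⟩
  rw [h k hmem, hTn, finMultiplier_eq c hkn (by linarith [ht.1]) (by linarith [ht.2]),
    finMultiplier_eq c hkn.le (by linarith [ht.1]) (by linarith [ht.2])]

/-- The signs alternate, so the sum is the constant slope of the affine factor. -/
theorem linearCoeff_sum {n k : ℕ} (hk : k < n) :
    linearCoeff (k + 1) (n - (k + 1)) + linearCoeff k (n - k) = (-1) ^ k / n := by
  obtain ⟨p, rfl⟩ := Nat.exists_eq_add_of_lt hk
  have e1 : k + p + 1 - (k + 1) = p := by omega
  have e2 : k + p + 1 - k = p + 1 := by omega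
  rw [e1, e2, linearCoeff, linearCoeff]
  push_cast
  have : (k : ℝ) + p + 1 ≠ 0 := by positivity
  rw [show (k : ℝ) + 1 + p = k + p + 1 by ring, show (k : ℝ) + (p + 1) = k + p + 1 by ring]
  field_simp
  ring

/-- The growing part comes from `1 / (1 - z ^ (-2n)) = -z ^ (2n) / (1 - z ^ (2n))`. -/
theorem geomCoeff_sum {z : ℝ} (hz : |z| < 1) (hz0 : z ≠ 0) {n k : ℕ} (hk : k < n) :
    geomCoeff z (k + 1) (n - (k + 1)) + geomCoeff z k (n - k)
      = z ^ k * ((1 + z) / (1 - z ^ (2 * n)))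
        + 1 / z ^ k * ((1 + 1 / z) / (1 - 1 / z ^ (2 * n))) := by
  obtain ⟨p, rfl⟩ := Nat.exists_eq_add_of_lt hk
  have e1 : k + p + 1 - (k + 1) = p := by omega
  have e2 : k + p + 1 - k = p + 1 := by omega
  rw [e1, e2, geomCoeff, geomCoeff, show k + 1 + p = k + p + 1 by ring,
    show k + (p + 1) = k + p + 1 by ring]
  have hd : z ^ (2 * (k + p + 1)) < 1 := pow_two_mul_lt_one hz (Nat.succ_ne_zero _)
  have hd1 : 1 - z ^ (2 * (k + p + 1)) ≠ 0 := by linarith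
  have hd2 : z ^ (2 * (k + p + 1)) - 1 ≠ 0 := by linarith
  have hp : z ^ (2 * (k + p + 1)) ≠ 0 := pow_ne_zero _ hz0
  have hk0 : z ^ k ≠ 0 := pow_ne_zero _ hz0
  have e3 : (1 + 1 / z) / (1 - 1 / z ^ (2 * (k + p + 1)))
      = -((1 + 1 / z) * z ^ (2 * (k + p + 1)) / (1 - z ^ (2 * (k + p + 1)))) := by
    rw [← neg_div, div_eq_div_iff (by
      rw [sub_ne_zero, ne_comm, one_div]
      exact fun h => hd.ne (inv_eq_one.1 h)) hd1]
    field_simp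
    ring
  rw [e3]
  generalize hD : 1 - z ^ (2 * (k + p + 1)) = D at hd1
  field_simp
  ring

theorem geomCoeff_zero_sum {n k : ℕ} (hk : k < n) :
    geomCoeff 0 (k + 1) (n - (k + 1)) + geomCoeff 0 k (n - k) = if k = 0 then 1 else 0 := by
  obtain ⟨p, rfl⟩ := Nat.exists_eq_add_of_lt hk
  have e2 : k + p + 1 - k = p + 1 := by omega
  rw [e2, geomCoeff, geomCoeff]
  by_cases h : k = 0
  · subst h; simp
  · simp [h]

/-- The parallelogram law for `(y₀' ± y₁) / 2`, after folding `(-1, 0)` onto `(0, 1)`. -/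
theorem integral_sq_profile (hΦ : MemLp Φ 2 volume)
    (hΦ0 : ∀ x, x ∉ Ioo (-1 : ℝ) 1 → Φ x = 0) (hF : ExtendsData y₀ y₁ Φ) :
    ∫ x, Φ x ^ 2 = 1 / 2 * ∫ x in (0 : ℝ)..1, (deriv y₀ x ^ 2 + y₁ x ^ 2) := by
  have hi : Integrable (fun x => Φ x ^ 2) volume := hΦ.integrable_sq
  have hi2 : Integrable (fun x => Φ (-x) ^ 2) volume := hi.comp_neg
  have e1 : ∫ x, Φ x ^ 2 = ∫ x in (-1 : ℝ)..1, Φ x ^ 2 := by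
    rw [intervalIntegral.integral_of_le (by norm_num), setIntegral_eq_integral_of_forall_compl_eq_zero]
    intro x hx
    rw [hΦ0 x fun h => hx (Ioo_subset_Ioc_self h)]
    norm_num
  have e2 := intervalIntegral.integral_comp_neg (a := 0) (b := 1) (fun x => Φ x ^ 2)
  rw [neg_zero] at e2
  rw [e1, ← intervalIntegral.integral_add_adjacent_intervals (b := 0) hi.intervalIntegrable
    hi.intervalIntegrable, ← e2, ← intervalIntegral.integral_add hi2.intervalIntegrable
    hi.intervalIntegrable, ← intervalIntegral.integral_const_mul, integral_zero_one_eq,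
    integral_zero_one_eq]
  apply integral_congr_ae
  filter_upwards [hF.ae_right, hF.ae_left] with x h1 h2
  rw [h1, h2]
  ring

/-- The interval `[2k - 1, 2k + 3)` consists of the periods `k` and `k + 1`. It contains every point
that the state sees at the times `t + 2k` with `0 < t < 2`, and the sum of both translates avoids a
case distinction later. -/
theorem sq_spread_top_le {z : ℝ} (hz : |z| < 1) (Φ : ℝ → ℝ) (k : ℕ) {x : ℝ}
    (h0 : 2 * (k : ℝ) - 1 ≤ x) (h1 : x < 2 * k + 3) :
    spread (topMultiplier z) Φ x ^ 2
      ≤ z ^ (2 * k) * (Φ (x - 2 * k) ^ 2 + Φ (x - 2 * (k + 1 : ℕ)) ^ 2) := by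
  have hzk : 0 ≤ z ^ (2 * k) := (even_two_mul k).pow_nonneg z
  rcases lt_or_ge x (2 * k + 1) with h | h
  · have e := spread_eq (m := topMultiplier z) (Φ := Φ) (r := x - 2 * k) (by linarith)
      (by linarith) k
    rw [topMultiplier_eq (by linarith) (by linarith), sub_add_cancel] at e
    rw [e]
    have := mul_nonneg hzk (sq_nonneg (Φ (x - 2 * (k + 1 : ℕ))))
    rw [mul_pow, ← pow_mul, mul_comm k 2]
    linarith
  · have e := spread_eq (m := topMultiplier z) (Φ := Φ) (r := x - 2 * (k + 1 : ℕ))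
      (by push_cast; linarith) (by push_cast; linarith) (k + 1)
    rw [topMultiplier_eq (by push_cast; linarith) (by push_cast; linarith), sub_add_cancel] at e
    rw [e, mul_pow, ← pow_mul, mul_comm (k + 1) 2]
    have h1 := mul_nonneg hzk (sq_nonneg (Φ (x - 2 * k)))
    have h2 : z ^ (2 * (k + 1)) ≤ z ^ (2 * k) := by
      rw [← (even_two_mul _).pow_abs, ← (even_two_mul k).pow_abs]
      exact pow_le_pow_of_le_one (abs_nonneg z) hz.le (by omega)
    have h3 := mul_le_mul_of_nonneg_right h2 (sq_nonneg (Φ (x - 2 * (k + 1 : ℕ))))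
    linarith

/-- Exponential decay of the optimal energy for the infinite horizon. -/
theorem energy_decay (h0 : 0 ≤ lam) (h1 : lam < 1) (hd : IsInitialData y₀ y₁) {u : Control ∞}
    (hu : IsOptimal ∞ lam y₀ y₁ u) {y v : ℝ → ℝ → ℝ} (hs : IsSolution ∞ y₀ y₁ u y v) {t : ℝ}
    (ht : t ∈ Ioo (0 : ℝ) 2) (k : ℕ) :
    (∫ x in (0 : ℝ)..1, (deriv (y (t + 2 * (k : ℝ))) x ^ 2 + v (t + 2 * (k : ℝ)) x ^ 2))
      ≤ 2 * |zRoot lam| ^ (2 * k) * ∫ x in (0 : ℝ)..1, (deriv y₀ x ^ 2 + y₁ x ^ 2) := by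
  obtain ⟨Φ, hΦm, hΦ, hΦ0, hF⟩ := hd.exists_profile
  have hm := isMultiplier_top h0 h1
  have hz := abs_zRoot_lt_one h0 h1
  have huG := (hm.optimal ⟨h0, h1.le⟩ le_top (fun _ => h1) hd hΦm hΦ hF u).1 hu
  have hprof := hm.isProfile hΦm hΦ hF
  have hG := hprof.locL2
  have hle : ∀ x, 2 * (k : ℝ) - 1 ≤ x → x < 2 * k + 3 → _ := fun x => sq_spread_top_le hz Φ k
  have hsG := hG.isSolution hd hprof.extendsData huG
  have hiΦ : Integrable (fun x => Φ x ^ 2) volume := hΦ.integrable_sq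
  set z := zRoot lam
  set G := spread (topMultiplier z) Φ
  set τ := t + 2 * (k : ℝ) with hτ
  have hk0 : (0 : ℝ) ≤ k := Nat.cast_nonneg k
  have hτm : τ ∈ timeInterval ∞ := by
    rw [timeInterval_top, mem_Ici]
    linarith [ht.1]
  set f : ℝ → ℝ := fun x => z ^ (2 * k) * (Φ (x - 2 * k) ^ 2 + Φ (x - 2 * (k + 1 : ℕ)) ^ 2)
  have hfi : Integrable f volume := ((hiΦ.comp_sub_right _).add (hiΦ.comp_sub_right _)).const_mul _
  have hf0 : ∀ x, 0 ≤ f x := fun x =>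
    mul_nonneg ((even_two_mul k).pow_nonneg z) (add_nonneg (sq_nonneg _) (sq_nonneg _))
  have hfint : ∫ x, f x = 2 * z ^ (2 * k) * ∫ x, Φ x ^ 2 := by
    rw [integral_const_mul, integral_add (hiΦ.comp_sub_right _) (hiΦ.comp_sub_right _),
      integral_sub_right_eq_self (fun x => Φ x ^ 2), integral_sub_right_eq_self (fun x => Φ x ^ 2)]
    ring
  have hfa : IntervalIntegrable (fun x => f (τ + x)) volume 0 1 :=
    (hfi.comp_add_left τ).intervalIntegrable
  have hfb : IntervalIntegrable (fun x => f (τ - x)) volume 0 1 :=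
    (hfi.comp_sub_left τ).intervalIntegrable
  -- The two waves read `f` on the adjacent intervals `[τ, τ + 1]` and `[τ - 1, τ]`, so their
  -- integrals add up to one over `[τ - 1, τ + 1]`.
  have hsum : ∫ x in (0 : ℝ)..1, (f (τ + x) + f (τ - x)) ≤ ∫ x, f x := by
    rw [intervalIntegral.integral_add hfa hfb, intervalIntegral.integral_comp_add_left,
      intervalIntegral.integral_comp_sub_left, add_comm, add_zero, sub_zero,
      intervalIntegral.integral_add_adjacent_intervals hfi.intervalIntegrable
        hfi.intervalIntegrable, intervalIntegral.integral_of_le (by linarith)]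
    exact setIntegral_le_integral hfi (.of_forall hf0)
  have henergy : ∫ x in (0 : ℝ)..1, (deriv (y τ) x ^ 2 + v τ x ^ 2)
      = ∫ x in (0 : ℝ)..1, 2 * (G (τ + x) ^ 2 + G (τ - x) ^ 2) := by
    rw [integral_zero_one_eq, integral_zero_one_eq]
    apply integral_congr_ae
    filter_upwards [ae_spaceMeasure_iff.2 (.of_forall fun x hx => hx), hG.deriv_posOf τ,
      hs.vel_eq le_top hsG (fun _ _ => rfl) hτm] with x hx e1 e2
    rw [hs.deriv_eq hsG (fun _ _ => rfl) hτm x hx, e1, e2, velOf]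
    ring
  have hmono : ∫ x in (0 : ℝ)..1, 2 * (G (τ + x) ^ 2 + G (τ - x) ^ 2)
      ≤ ∫ x in (0 : ℝ)..1, 2 * (f (τ + x) + f (τ - x)) := by
    have hfab := (hfa.add hfb).const_mul 2
    have hgi : Integrable (fun x => 2 * (G (τ + x) ^ 2 + G (τ - x) ^ 2)) spaceMeasure :=
      ((hG.memLp_add τ).integrable_sq.add (hG.memLp_sub τ).integrable_sq).const_mul 2
    have hgi' : IntervalIntegrable (fun x => 2 * (G (τ + x) ^ 2 + G (τ - x) ^ 2)) volume 0 1 := by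
      rw [intervalIntegrable_iff_integrableOn_Ioo_of_le zero_le_one]
      exact hgi
    refine intervalIntegral.integral_mono_on_of_le_Ioo zero_le_one hgi' hfab fun x hx => ?_
    have a1 := hle (τ + x) (by linarith [ht.1, hx.1]) (by linarith [ht.2, hx.2])
    have a2 := hle (τ - x) (by linarith [ht.1, hx.2]) (by linarith [ht.2, hx.1])
    have : G (τ + x) ^ 2 + G (τ - x) ^ 2 ≤ f (τ + x) + f (τ - x) := add_le_add a1 a2
    linarith
  rw [henergy]
  refine hmono.trans ?_
  rw [intervalIntegral.integral_const_mul, (even_two_mul k).pow_abs]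
  have hI := integral_sq_profile hΦ hΦ0 hF
  -- The factors are `2` from the energy, `2` from the two translates in `f`, and `1 / 2` from the
  -- norm of the profile.
  calc 2 * ∫ x in (0 : ℝ)..1, (f (τ + x) + f (τ - x)) ≤ 2 * ∫ x, f x := by linarith
    _ = _ := by rw [hfint, hI]; ring

/-- The optimal control for the infinite horizon. -/
theorem infinite_horizon_formula (h0 : 0 ≤ lam) (h1 : lam < 1) (hd : IsInitialData y₀ y₁)
    {u : Control ∞} (hu : IsOptimal ∞ lam y₀ y₁ u) :
    ∀ᵐ t ∂(volume.restrict (Ioo (0 : ℝ) 2)), ∀ k : ℕ,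
      u (t + 2 * (k : ℝ)) = zRoot lam ^ k * ((1 + zRoot lam) * F y₀ y₁ (t - 1)) := by
  filter_upwards [(isMultiplier_top h0 h1).optimal_formula ⟨h0, h1.le⟩ le_top (fun _ => h1) hd hu,
    ae_restrict_mem measurableSet_Ioo] with t h ht k
  have hk0 : (0 : ℝ) ≤ k := Nat.cast_nonneg k
  have hmem : t + 2 * (k : ℝ) ∈ timeInterval ∞ := by
    rw [timeInterval_top, mem_Ici]
    linarith [ht.1]
  rw [h k hmem, topMultiplier_eq (by linarith [ht.1]) (by linarith [ht.2]),
    topMultiplier_eq (by linarith [ht.1]) (by linarith [ht.2])]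
  ring

theorem ae_Ioo_zero_one {p : ℝ → Prop} (h : ∀ᵐ t ∂(volume.restrict (Ioo (0 : ℝ) 2)), p t) :
    ∀ᵐ t ∂(volume.restrict (Ioo (0 : ℝ) 1)), t < 1 ∧ p t :=
  ((ae_restrict_mem measurableSet_Ioo).mono fun _ ht => ht.2).and
    (ae_restrict_of_ae_restrict_of_subset (Ioo_subset_Ioo_right one_le_two) h)

theorem ae_Ioo_one_two {p : ℝ → Prop} (h : ∀ᵐ t ∂(volume.restrict (Ioo (0 : ℝ) 2)), p t) :
    ∀ᵐ t ∂(volume.restrict (Ioo (1 : ℝ) 2)), (1 < t ∧ t < 2) ∧ p t :=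
  (ae_restrict_mem measurableSet_Ioo).and
    (ae_restrict_of_ae_restrict_of_subset (Ioo_subset_Ioo_left zero_le_one) h)

/-- The optimal control for an even horizon and `lam = 1`. -/
theorem even_horizon_formula_one {n : ℕ} (hTn : T.toReal = 2 * (n : ℝ)) (hT2 : 2 ≤ T)
    (hT : T ≠ ∞) (hd : IsInitialData y₀ y₁) {u : Control T} (hu : IsOptimal T 1 y₀ y₁ u) :
    ∀ᵐ t ∂(volume.restrict (Ioo (0 : ℝ) 2)), ∀ k : ℕ, t + 2 * (k : ℝ) ≤ 2 * (n : ℝ) →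
      u (t + 2 * (k : ℝ)) = (-1) ^ k / n * F y₀ y₁ (t - 1) := by
  filter_upwards [even_horizon_formula hTn hT2 hT (isMultiplier_linear hT2 hT) (by simp) hd hu]
    with t h k hk
  obtain ⟨hkn, e⟩ := h k hk
  rw [e, linearCoeff_sum hkn]

end

end WaveOCP

/-! ### Assembly of the cases. -/

theorem theorem1 (lam : ℝ) (hlam : lam ∈ Icc (0 : ℝ) 1) :
    -- existence and uniqueness
    (∀ (T : ℝ≥0∞), 2 ≤ T → (T = ∞ → lam < 1) →
      ∀ y₀ y₁ : ℝ → ℝ, WaveOCP.IsInitialData y₀ y₁ →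
        ∃! u : WaveOCP.Control T, WaveOCP.IsOptimal T lam y₀ y₁ u) ∧
    -- the case of a finite horizon that is an even integer
    (∀ n : ℕ, 1 ≤ n → ∀ y₀ y₁ : ℝ → ℝ, WaveOCP.IsInitialData y₀ y₁ →
      ∀ u : WaveOCP.Control (2 * (n : ℝ≥0∞)), WaveOCP.IsOptimal (2 * (n : ℝ≥0∞)) lam y₀ y₁ u →
        (lam = 1 →
          (∀ᵐ t ∂(volume.restrict (Ioo (0 : ℝ) 2)), ∀ k : ℕ, t + 2 * (k : ℝ) ≤ 2 * (n : ℝ) →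
            u (t + 2 * (k : ℝ)) = (-1) ^ k * u t) ∧
          (∀ᵐ t ∂(volume.restrict (Ioo (0 : ℝ) 1)),
            u t = 1 / (2 * (n : ℝ)) * (deriv y₀ (1 - t) - y₁ (1 - t))) ∧
          (∀ᵐ t ∂(volume.restrict (Ioo (1 : ℝ) 2)),
            u t = 1 / (2 * (n : ℝ)) * (deriv y₀ (t - 1) + y₁ (t - 1)))) ∧
        (0 < lam → lam < 1 →
          WaveOCP.zRoot lam ∈ Ioo (-1 : ℝ) 0 ∧
          ∀ᵐ t ∂(volume.restrict (Ioo (0 : ℝ) 2)), ∀ k : ℕ, t + 2 * (k : ℝ) ≤ 2 * (n : ℝ) →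
            u (t + 2 * (k : ℝ)) = WaveOCP.zRoot lam ^ k * WaveOCP.fPlus lam n y₀ y₁ t
              + 1 / WaveOCP.zRoot lam ^ k * WaveOCP.fMinus lam n y₀ y₁ t) ∧
        (lam = 0 →
          ∀ᵐ t ∂(volume.restrict (Ioo (0 : ℝ) 2)), ∀ k : ℕ, t + 2 * (k : ℝ) ≤ 2 * (n : ℝ) →
            u (t + 2 * (k : ℝ)) = if k = 0 then WaveOCP.F y₀ y₁ (t - 1) else 0)) ∧
    -- the case of an infinite horizon
    (lam < 1 → ∃ C₀ : ℝ, 0 < C₀ ∧ ∀ y₀ y₁ : ℝ → ℝ, WaveOCP.IsInitialData y₀ y₁ →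
      ∀ u : WaveOCP.Control ∞, WaveOCP.IsOptimal ∞ lam y₀ y₁ u →
        (lam = 0 → ∀ w : WaveOCP.Control 2, WaveOCP.IsOptimal 2 1 y₀ y₁ w →
          ∀ᵐ t ∂(volume.restrict (Icc (0 : ℝ) 2)), u t = w t) ∧
        (∀ᵐ t ∂(volume.restrict (Ioo (0 : ℝ) 1)),
          u t = (1 + WaveOCP.zRoot lam) / 2 * (deriv y₀ (1 - t) - y₁ (1 - t))) ∧
        (∀ᵐ t ∂(volume.restrict (Ioo (1 : ℝ) 2)),
          u t = (1 + WaveOCP.zRoot lam) / 2 * (deriv y₀ (t - 1) + y₁ (t - 1))) ∧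
        (∀ᵐ t ∂(volume.restrict (Ioo (0 : ℝ) 2)), ∀ k : ℕ, 1 ≤ k →
          u (t + 2 * (k : ℝ)) = WaveOCP.zRoot lam ^ k * u t) ∧
        (∀ y v : ℝ → ℝ → ℝ, WaveOCP.IsSolution ∞ y₀ y₁ u y v →
          ∀ t ∈ Ioo (0 : ℝ) 2, ∀ k : ℕ, 1 ≤ k →
            (∫ x in (0 : ℝ)..1,
                (deriv (y (t + 2 * (k : ℝ))) x ^ 2 + v (t + 2 * (k : ℝ)) x ^ 2))
              ≤ C₀ * |WaveOCP.zRoot lam| ^ (2 * k)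
                * ∫ x in (0 : ℝ)..1, (deriv y₀ x ^ 2 + y₁ x ^ 2))) := by
  refine ⟨fun T hT2 hT y₀ y₁ hd => ?_, fun n hn y₀ y₁ hd u hu => ?_, fun hlt => ?_⟩
  · by_cases hTtop : T = ∞
    · subst hTtop
      exact (WaveOCP.isMultiplier_top hlam.1 (hT rfl)).existsUnique hlam hT2 hT hd
    · rcases lt_or_eq_of_le hlam.2 with hl | rfl
      · exact (WaveOCP.isMultiplier_geom hT2 hTtop hlam.1 hl).existsUnique hlam hT2 hT hd
      · exact (WaveOCP.isMultiplier_linear hT2 hTtop).existsUnique hlam hT2 hT hd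
  · have hn1 : (1 : ℝ) ≤ n := by exact_mod_cast hn
    have hTn : (2 * (n : ℝ≥0∞)).toReal = 2 * (n : ℝ) := by simp
    have hTtop : (2 * (n : ℝ≥0∞)) ≠ ∞ := ENNReal.mul_ne_top (by simp) (by simp)
    have hT2 : 2 ≤ 2 * (n : ℝ≥0∞) := le_mul_of_one_le_right' (by exact_mod_cast hn)
    refine ⟨?_, fun h0 h1 => ?_, ?_⟩
    · rintro rfl
      have h := WaveOCP.even_horizon_formula_one hTn hT2 hTtop hd hu
      have hfirst : ∀ᵐ t ∂(volume.restrict (Ioo (0 : ℝ) 2)),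
          u t = 1 / (n : ℝ) * WaveOCP.F y₀ y₁ (t - 1) := by
        filter_upwards [h, ae_restrict_mem measurableSet_Ioo] with t h ht
        have := h 0 (by simp only [Nat.cast_zero, mul_zero, add_zero]; linarith [ht.2])
        simpa using this
      refine ⟨?_, ?_, ?_⟩
      · filter_upwards [h, hfirst] with t h h' k hk
        rw [h k hk, h']
        ring
      · filter_upwards [WaveOCP.ae_Ioo_zero_one hfirst] with t ⟨ht, e⟩
        rw [e, WaveOCP.F_sub_one_of_lt ht]
        field_simp
      · filter_upwards [WaveOCP.ae_Ioo_one_two hfirst] with t ⟨ht, e⟩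
        rw [e, WaveOCP.F_sub_one_of_le ht.1.le]
        field_simp
    · have hz0 := WaveOCP.zRoot_neg h0 h1
      refine ⟨⟨(WaveOCP.zRoot_mem h0.le h1).1, hz0⟩, ?_⟩
      filter_upwards [WaveOCP.even_horizon_formula hTn hT2 hTtop
        (WaveOCP.isMultiplier_geom hT2 hTtop h0.le h1) hlam hd hu] with t h k hk
      obtain ⟨hkn, e⟩ := h k hk
      rw [e, WaveOCP.geomCoeff_sum (WaveOCP.abs_zRoot_lt_one h0.le h1) hz0.ne hkn, WaveOCP.fPlus,
        WaveOCP.fMinus]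
      ring
    · rintro rfl
      filter_upwards [WaveOCP.even_horizon_formula hTn hT2 hTtop
        (WaveOCP.isMultiplier_geom hT2 hTtop le_rfl one_pos) hlam hd hu] with t h k hk
      obtain ⟨hkn, e⟩ := h k hk
      rw [e, WaveOCP.zRoot_zero, WaveOCP.geomCoeff_zero_sum hkn, ite_mul, one_mul, zero_mul]
  · refine ⟨2, two_pos, fun y₀ y₁ hd u hu => ?_⟩
    have h := WaveOCP.infinite_horizon_formula hlam.1 hlt hd hu
    have hfirst : ∀ᵐ t ∂(volume.restrict (Ioo (0 : ℝ) 2)),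
        u t = (1 + WaveOCP.zRoot lam) * WaveOCP.F y₀ y₁ (t - 1) := by
      filter_upwards [h] with t h
      simpa using h 0
    refine ⟨?_, ?_, ?_, ?_, fun y v hs t ht k _ => WaveOCP.energy_decay hlam.1 hlt hd hu hs ht k⟩
    -- Since `z₀ = 0`, the infinite-horizon control on `(0, 2)` is `F (t - 1)`, and so is the `λ =
    -- 1` control for `n = 1`.
    · rintro rfl w hw
      rw [← restrict_Ioo_eq_restrict_Icc]
      filter_upwards [hfirst, WaveOCP.even_horizon_formula_one (n := 1) (by simp) le_rfl (by simp)
        hd hw, ae_restrict_mem measurableSet_Ioo] with t h1 h2 ht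
      have e := h2 0 (by simp only [Nat.cast_zero, mul_zero, add_zero, Nat.cast_one]; linarith [ht.2])
      rw [h1, WaveOCP.zRoot_zero]
      simpa using e.symm
    · filter_upwards [WaveOCP.ae_Ioo_zero_one hfirst] with t ⟨ht, e⟩
      rw [e, WaveOCP.F_sub_one_of_lt ht]
      ring
    · filter_upwards [WaveOCP.ae_Ioo_one_two hfirst] with t ⟨ht, e⟩
      rw [e, WaveOCP.F_sub_one_of_le ht.1.le]
      ring
    · filter_upwards [h, hfirst] with t h h' k _
      rw [h k, h']
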